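/- **Definitions.** An *AECat* is an accessible category that has directed colimits and in which every morphism is a monomorphism. A *reduct functor* is a faithful functor between AECats that preserves directed colimits. An *independence relation* $\perp$ on a category $\mathcal C$ is a class of commuting squares. The square $X\to A\to M$, $X\to B\to M$ is denoted $A\perp_X^M B$ if it lies in the class, and is then called *independent*. We consider the following properties. * *Invariance*: for every commuting square with vertex $M$ and every $M\to N$, $A\perp_X^M B$ iff $A\perp_X^N B$. * *Monotonicity*: if $A\perp_X^M B$ and $X\to B$ factors as $X\to B'\to B$, then $A\perp_X^M B'$. * *Transitivity*: if $A\perp_X^M B$ and $M\perp_B^N D$ then $A\perp_X^N D$. * *Symmetry*: $A\perp_X^M B$ iff $B\perp_X^M A$. * *Existence*: every span can be completed to an independent square. * *Base monotonicity*: given $X\to B\to D$ and $A\perp_X^M D$, there are $A\to A'$, $B\to A'$, $A'\to N$, $M\to N$ making everything commute with $A'\perp_B^N D$. * *Uniqueness*: any two independent squares with the same base span can be amalgamated. Here squares $A\to M\leftarrow B$ and $A\to M'\leftarrow B$ over the same span can be *amalgamated* if there are $M\to E\leftarrow M'$ such that the two composites $A\to E$ agree and the two composites $B\to E$ agree. *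 *3-amalgamation*: an *independent horn* consists of morphisms from $M$ to $A,B,C$ and independent squares $A\perp_M^{N_1}B$, $A\perp_M^{N_2}C$, $B\perp_M^{N_3}C$. Every independent horn can be completed by morphisms $N_i\to N$ to a commuting cube with $A\perp_M^N N_3$. * *Strong 3-amalgamation*: every independent horn can be completed to an *independent cube*, i.e. a commuting cube all six faces of which are independent. Basic existence (every commuting square with $X\to A$ or $X\to B$ an isomorphism is independent) follows from invariance and existence. When basic existence and transitivity hold, let $\mathcal C_\perp$ be the subcategory of the arrow category $\mathcal C^2$ with all objects, and with the independent squares as morphisms. Then $\perp$ is *accessible* if $\mathcal C_\perp$ is accessible, and satisfies *union* if $\mathcal C_\perp$ has directed colimits and $\mathcal C_\perp\hookrightarrow\mathcal C^2$ preserves them. The relation $\perp$ is *NSOP$_1$-like* if it is accessible and satisfies invariance, monotonicity, transitivity, symmetry, existence, 3-amalgamation and union; *simple* if it is NSOP$_1$-like and satisfies base monotonicity; *stable* if it is simple and satisfies uniqueness. Let $F:\mathcal C\to\mathcal D$ be a faithful functor and $\perp$ an independence relation on $\mathcal D$. The *lift* $F^{-1}(\perp)$ consists of the commuting squares of $\mathcal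 C$ whose image under $F$ is independent. * $F$ *reflects amalgamation of squares* if two commuting squares in $\mathcal C$ with the same base span can be amalgamated whenever their images under $F$ can be amalgamated in $\mathcal D$. * A *2-completion* of a commuting square in $\mathcal D$ with base span $F(A)\leftarrow F(X)\to F(B)$ in the image of $F$ and vertex $N$ consists of an object $E$ of $\mathcal C$, a morphism $N\to F(E)$ of $\mathcal D$, and morphisms $A\to E$, $B\to E$ of $\mathcal C$ whose images under $F$ are the composites $F(A)\to N\to F(E)$ and $F(B)\to N\to F(E)$. $F$ *admits 2-completions* if every such square that is independent has a 2-completion. * $F$ *admits 3-completions* if for every independent cube in $\mathcal D$ consisting of the image under $F$ of a horn ($M,A,B,C,N_1,N_2,N_3$) and morphisms $F(N_i)\to N$, there are $N^*$ in $\mathcal C$, $N\to F(N^*)$ in $\mathcal D$ and $n_i:N_i\to N^*$ in $\mathcal C$ such that $F(n_i)$ is the composite $F(N_i)\to N\to F(N^*)$ for $i=1,2,3$. * $F$ has *$\perp$-independent horn amalgamation* if for every horn in $\mathcal C$ (notation as above) whose image under $F$ is an independent horn, and every independent square $F(A)\perp_{F(M)}^{N}F(N_3)$, this square has a 2-completion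 $N\to F(N^*)$, $a^*:A\to N^*$, $n_3:N_3\to N^*$ such that the following two pairs of squares can be amalgamated in $\mathcal C$: the squares $A\to N_1\leftarrow B$ and $A\xrightarrow{a^*}N^*\leftarrow N_3\leftarrow B$ over $A\leftarrow M\to B$, and the squares $A\to N_2\leftarrow C$ and $A\xrightarrow{a^*}N^*\leftarrow N_3\leftarrow C$ over $A\leftarrow M\to C$. **Theorem.** Let $F:\mathcal C\to\mathcal D$ be a reduct functor and $\perp$ an independence relation on $\mathcal D$ such that $F$ admits 2-completions with respect to $\perp$. 1. If $\perp$ is stable and $F$ reflects amalgamation of squares, then $F^{-1}(\perp)$ is stable. 2. If $\perp$ is simple, $\mathcal C$ and $\mathcal D$ have binary joins of subobjects, $F$ preserves those joins, and either $F$ has $\perp$-independent horn amalgamation or $F$ admits 3-completions with respect to $\perp$, then $F^{-1}(\perp)$ is simple. 3. If $\perp$ is NSOP$_1$-like and $F$ has $\perp$-independent horn amalgamation, then $F^{-1}(\perp)$ is NSOP$_1$-like. 4. If $\perp$ is NSOP$_1$-like with strong 3-amalgamation and $F$ admits 3-completions with respect to $\perp$, then $F^{-1}(\perp)$ is NSOP$_1$-like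 with strong 3-amalgamation. -/

import Mathlib

open CategoryTheory CategoryTheory.Limits

universe v u v₁ u₁ v₂ u₂

namespace IndepLift

/-- An independence relation on a category: a class of commuting squares. A square
```
  A --a--> M
  ^        ^
  f        b
  |        |
  X --g--> B
```
is recorded as `indep f g a b`, read "`A` is independent from `B` over `X` in `M`". -/
@[ext]
structure IndependenceRelation (C : Type u) [Category.{v} C] where
  indep : ∀ ⦃X A B M : C⦄, (X ⟶ A) → (X ⟶ B) → (A ⟶ M) → (B ⟶ M) → Prop
  comm : ∀ ⦃X A B M : C⦄ {f : X ⟶ A} {g : X ⟶ B} {a : A ⟶ M} {b : B ⟶ M},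
    indep f g a b → f ≫ a = g ≫ b

/-- Two squares with the same base span, `(a, b)` into `D` and `(a', b')` into `D'`,
can be amalgamated. -/
def CanAmalgamate {C : Type u} [Category.{v} C] {A B D D' : C}
    (a : A ⟶ D) (b : B ⟶ D) (a' : A ⟶ D') (b' : B ⟶ D') : Prop :=
  ∃ (E : C) (d : D ⟶ E) (d' : D' ⟶ E), a ≫ d = a' ≫ d' ∧ b ≫ d = b' ≫ d'

/-- All colimits of diagrams indexed by small (nonempty) directed posets exist. -/
def HasDirectedColimits (C : Type u) [Category.{v} C] : Prop :=
  ∀ (J : Type v) [PartialOrder J] [IsDirectedOrder J] [Nonempty J], HasColimitsOfShape J C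

/-- The functor preserves all colimits of diagrams indexed by small (nonempty) directed posets
(small: in the common universe of the hom-sets). -/
def PreservesDirectedColimits {C : Type u₁} [Category.{v} C] {D : Type u₂} [Category.{v} D]
    (F : C ⥤ D) : Prop :=
  ∀ (J : Type v) [PartialOrder J] [IsDirectedOrder J] [Nonempty J], PreservesColimitsOfShape J F

namespace IndependenceRelation

variable {C : Type u} [Category.{v} C] (R : IndependenceRelation C)

def Invariance : Prop :=
  ∀ ⦃X A B M N : C⦄ (f : X ⟶ A) (g : X ⟶ B) (a : A ⟶ M) (b : B ⟶ M) (n : M ⟶ N),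
    f ≫ a = g ≫ b → (R.indep f g a b ↔ R.indep f g (a ≫ n) (b ≫ n))

def Monotonicity : Prop :=
  ∀ ⦃X A B' B M : C⦄ (f : X ⟶ A) (g : X ⟶ B') (h : B' ⟶ B) (a : A ⟶ M) (b : B ⟶ M),
    R.indep f (g ≫ h) a b → R.indep f g a (h ≫ b)

def Transitivity : Prop :=
  ∀ ⦃X A B M D N : C⦄ (f : X ⟶ A) (g : X ⟶ B) (a : A ⟶ M) (b : B ⟶ M)
    (d : B ⟶ D) (m : M ⟶ N) (n : D ⟶ N),
    R.indep f g a b → R.indep b d m n → R.indep f (g ≫ d) (a ≫ m) n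

def Symmetry : Prop :=
  ∀ ⦃X A B M : C⦄ (f : X ⟶ A) (g : X ⟶ B) (a : A ⟶ M) (b : B ⟶ M),
    R.indep f g a b ↔ R.indep g f b a

def BasicExistence : Prop :=
  ∀ ⦃X A B M : C⦄ (f : X ⟶ A) (g : X ⟶ B) (a : A ⟶ M) (b : B ⟶ M),
    f ≫ a = g ≫ b → (IsIso f ∨ IsIso g) → R.indep f g a b

def Existence : Prop :=
  ∀ ⦃X A B : C⦄ (f : X ⟶ A) (g : X ⟶ B),
    ∃ (M : C) (a : A ⟶ M) (b : B ⟶ M), R.indep f g a b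

def BaseMonotonicity : Prop :=
  ∀ ⦃X A B D M : C⦄ (f : X ⟶ A) (g : X ⟶ B) (h : B ⟶ D) (a : A ⟶ M) (d : D ⟶ M),
    R.indep f (g ≫ h) a d →
    ∃ (A' N : C) (p : A ⟶ A') (q : B ⟶ A') (r : A' ⟶ N) (s : M ⟶ N),
      f ≫ p = g ≫ q ∧ p ≫ r = a ≫ s ∧ R.indep q h r (d ≫ s)

def Uniqueness : Prop :=
  ∀ ⦃X A B M M' : C⦄ (f : X ⟶ A) (g : X ⟶ B) (a : A ⟶ M) (b : B ⟶ M)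
    (a' : A ⟶ M') (b' : B ⟶ M'),
    R.indep f g a b → R.indep f g a' b' → CanAmalgamate a b a' b'

/-- The horn consisting of the three squares on the spans `A ← M → B`, `A ← M → C'`,
`B ← M → C'` with vertices `N₁`, `N₂`, `N₃` is independent. -/
structure IsIndepHorn {M A B C' N₁ N₂ N₃ : C} (mA : M ⟶ A) (mB : M ⟶ B) (mC : M ⟶ C')
    (a₁ : A ⟶ N₁) (b₁ : B ⟶ N₁) (a₂ : A ⟶ N₂) (c₂ : C' ⟶ N₂)
    (b₃ : B ⟶ N₃) (c₃ : C' ⟶ N₃) : Prop where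
  indep₁ : R.indep mA mB a₁ b₁
  indep₂ : R.indep mA mC a₂ c₂
  indep₃ : R.indep mB mC b₃ c₃

/-- The horn, completed to a cube by `n₁`, `n₂`, `n₃`, is an independent cube:
all six faces are independent (in particular they commute). -/
structure IsIndepCube {M A B C' N₁ N₂ N₃ N : C} (mA : M ⟶ A) (mB : M ⟶ B) (mC : M ⟶ C')
    (a₁ : A ⟶ N₁) (b₁ : B ⟶ N₁) (a₂ : A ⟶ N₂) (c₂ : C' ⟶ N₂)
    (b₃ : B ⟶ N₃) (c₃ : C' ⟶ N₃) (n₁ : N₁ ⟶ N) (n₂ : N₂ ⟶ N) (n₃ : N₃ ⟶ N) : Prop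
    extends R.IsIndepHorn mA mB mC a₁ b₁ a₂ c₂ b₃ c₃ where
  indepA : R.indep a₁ a₂ n₁ n₂
  indepB : R.indep b₁ b₃ n₁ n₃
  indepC : R.indep c₂ c₃ n₂ n₃

def ThreeAmalgamation : Prop :=
  ∀ ⦃M A B C' N₁ N₂ N₃ : C⦄ (mA : M ⟶ A) (mB : M ⟶ B) (mC : M ⟶ C')
    (a₁ : A ⟶ N₁) (b₁ : B ⟶ N₁) (a₂ : A ⟶ N₂) (c₂ : C' ⟶ N₂) (b₃ : B ⟶ N₃) (c₃ : C' ⟶ N₃),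
    R.IsIndepHorn mA mB mC a₁ b₁ a₂ c₂ b₃ c₃ →
    ∃ (N : C) (n₁ : N₁ ⟶ N) (n₂ : N₂ ⟶ N) (n₃ : N₃ ⟶ N),
      a₁ ≫ n₁ = a₂ ≫ n₂ ∧ b₁ ≫ n₁ = b₃ ≫ n₃ ∧ c₂ ≫ n₂ = c₃ ≫ n₃ ∧
      R.indep mA (mB ≫ b₃) (a₁ ≫ n₁) n₃

def StrongThreeAmalgamation : Prop :=
  ∀ ⦃M A B C' N₁ N₂ N₃ : C⦄ (mA : M ⟶ A) (mB : M ⟶ B) (mC : M ⟶ C')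
    (a₁ : A ⟶ N₁) (b₁ : B ⟶ N₁) (a₂ : A ⟶ N₂) (c₂ : C' ⟶ N₂) (b₃ : B ⟶ N₃) (c₃ : C' ⟶ N₃),
    R.IsIndepHorn mA mB mC a₁ b₁ a₂ c₂ b₃ c₃ →
    ∃ (N : C) (n₁ : N₁ ⟶ N) (n₂ : N₂ ⟶ N) (n₃ : N₃ ⟶ N),
      R.IsIndepCube mA mB mC a₁ b₁ a₂ c₂ b₃ c₃ n₁ n₂ n₃

/-- The independent squares as a class of morphisms of the arrow category: a square is a
morphism from its left vertical arrow to its right vertical arrow. -/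
def squares : MorphismProperty (Arrow C) :=
  fun X Y φ => R.indep X.hom φ.left φ.right Y.hom

variable {R}

theorem basicExistence_of (hi : R.Invariance) (he : R.Existence) : R.BasicExistence := by
  intro X A B M f g a b w h
  obtain ⟨M', a', b', h'⟩ := he f g
  have w' := R.comm h'
  rcases h with hf | hg
  · have e' : a' = (inv f ≫ g) ≫ b' := by simp [← w']
    have e : a = (inv f ≫ g) ≫ b := by simp [← w]
    have h1 : R.indep f g (inv f ≫ g) (𝟙 B) :=
      (hi f g (inv f ≫ g) (𝟙 B) b' (by simp)).2 (by rw [← e', Category.id_comp]; exact h')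
    have h2 := (hi f g (inv f ≫ g) (𝟙 B) b (by simp)).1 h1
    rwa [← e, Category.id_comp] at h2
  · have e' : b' = (inv g ≫ f) ≫ a' := by simp [w']
    have e : b = (inv g ≫ f) ≫ a := by simp [w]
    have h1 : R.indep f g (𝟙 A) (inv g ≫ f) :=
      (hi f g (𝟙 A) (inv g ≫ f) a' (by simp)).2 (by rw [← e', Category.id_comp]; exact h')
    have h2 := (hi f g (𝟙 A) (inv g ≫ f) a (by simp)).1 h1
    rwa [← e, Category.id_comp] at h2

theorem squares_isMultiplicative (hb : R.BasicExistence) (ht : R.Transitivity) :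
    R.squares.IsMultiplicative where
  id_mem X := hb X.hom (𝟙 X.left) (𝟙 X.right) X.hom (by simp) (Or.inr inferInstance)
  comp_mem φ ψ h h' := ht _ _ _ _ _ _ _ h h'

variable (R)

/-- The category `C_⫫` of arrows of `C` and independent squares is accessible. -/
def Accessible (hb : R.BasicExistence) (ht : R.Transitivity) : Prop :=
  haveI := squares_isMultiplicative hb ht
  IsAccessibleCategory.{v} (WideSubcategory R.squares)

/-- `C_⫫` has directed colimits and the inclusion into the arrow category preserves them. -/
def Union (hb : R.BasicExistence) (ht : R.Transitivity) : Prop :=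
  haveI := squares_isMultiplicative hb ht
  HasDirectedColimits (WideSubcategory R.squares) ∧
    PreservesDirectedColimits (wideSubcategoryInclusion R.squares)

structure IsNSOP₁Like : Prop where
  invariance : R.Invariance
  monotonicity : R.Monotonicity
  transitivity : R.Transitivity
  symmetry : R.Symmetry
  existence : R.Existence
  threeAmalgamation : R.ThreeAmalgamation
  accessible : R.Accessible (basicExistence_of invariance existence) transitivity
  union : R.Union (basicExistence_of invariance existence) transitivity

structure IsSimple : Prop extends R.IsNSOP₁Like where
  baseMonotonicity : R.BaseMonotonicity

structure IsStable : Prop extends R.IsSimple where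
  uniqueness : R.Uniqueness

end IndependenceRelation

structure IsAECat (C : Type u) [Category.{v} C] : Prop where
  accessible : IsAccessibleCategory.{v} C
  hasDirectedColimits : HasDirectedColimits C
  mono : ∀ ⦃X Y : C⦄ (f : X ⟶ Y), Mono f

/-- Any two subobjects of an object have a join, i.e. a least upper bound in the poset of
subobjects. -/
def HasBinaryJoinsOfSubobjects (C : Type u) [Category.{v} C] : Prop :=
  ∀ (M : C) (P Q : Subobject M), ∃ J : Subobject M, IsLUB {P, Q} J

section Functors

variable {C : Type u₁} [Category.{v₁} C] {D : Type u₂} [Category.{v₂} D]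

structure PreservesBinaryJoinsOfSubobjects (F : C ⥤ D) : Prop where
  preservesMono : F.PreservesMonomorphisms
  isLUB : ∀ ⦃M A B J : C⦄ (a : A ⟶ M) (b : B ⟶ M) (j : J ⟶ M) [Mono a] [Mono b] [Mono j],
    IsLUB {Subobject.mk a, Subobject.mk b} (Subobject.mk j) →
    IsLUB {Subobject.mk (F.map a), Subobject.mk (F.map b)} (Subobject.mk (F.map j))

/-- The lift of `R` along `F`: a commuting square is independent iff its image is. -/
def lift (F : C ⥤ D) (R : IndependenceRelation D) : IndependenceRelation C where
  indep _ _ _ _ f g a b := f ≫ a = g ≫ b ∧ R.indep (F.map f) (F.map g) (F.map a) (F.map b)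
  comm _ _ _ _ _ _ _ _ h := h.1

def ReflectsAmalgamationOfSquares (F : C ⥤ D) : Prop :=
  ∀ ⦃X A B E E' : C⦄ (f : X ⟶ A) (g : X ⟶ B) (a : A ⟶ E) (b : B ⟶ E) (a' : A ⟶ E') (b' : B ⟶ E'),
    f ≫ a = g ≫ b → f ≫ a' = g ≫ b' →
    CanAmalgamate (F.map a) (F.map b) (F.map a') (F.map b') → CanAmalgamate a b a' b'

/-- A 2-completion of a square with vertices `F A`, `F B`, `N`: an object `E`, morphisms
`p : A ⟶ E`, `q : B ⟶ E` and `h : N ⟶ F E` with `a ≫ h = F p` and `b ≫ h = F q`. -/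
def IsTwoCompletion (F : C ⥤ D) {A B : C} {N : D} (a : F.obj A ⟶ N) (b : F.obj B ⟶ N)
    {E : C} (p : A ⟶ E) (q : B ⟶ E) (h : N ⟶ F.obj E) : Prop :=
  a ≫ h = F.map p ∧ b ≫ h = F.map q

def AdmitsTwoCompletions (F : C ⥤ D) (R : IndependenceRelation D) : Prop :=
  ∀ ⦃X A B : C⦄ ⦃N : D⦄ (f : X ⟶ A) (g : X ⟶ B) (a : F.obj A ⟶ N) (b : F.obj B ⟶ N),
    R.indep (F.map f) (F.map g) a b →
    ∃ (E : C) (p : A ⟶ E) (q : B ⟶ E) (h : N ⟶ F.obj E), IsTwoCompletion F a b p q h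

/-- Every independent cube in `D`, all of whose vertices except the terminal one are in the image
of `F` together with the morphisms between them, has a 3-completion. -/
def AdmitsThreeCompletions (F : C ⥤ D) (R : IndependenceRelation D) : Prop :=
  ∀ ⦃M A B C' N₁ N₂ N₃ : C⦄ ⦃N : D⦄ (mA : M ⟶ A) (mB : M ⟶ B) (mC : M ⟶ C')
    (a₁ : A ⟶ N₁) (b₁ : B ⟶ N₁) (a₂ : A ⟶ N₂) (c₂ : C' ⟶ N₂) (b₃ : B ⟶ N₃) (c₃ : C' ⟶ N₃)
    (k₁ : F.obj N₁ ⟶ N) (k₂ : F.obj N₂ ⟶ N) (k₃ : F.obj N₃ ⟶ N),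
    R.IsIndepCube (F.map mA) (F.map mB) (F.map mC) (F.map a₁) (F.map b₁) (F.map a₂) (F.map c₂)
      (F.map b₃) (F.map c₃) k₁ k₂ k₃ →
    ∃ (E : C) (n₁ : N₁ ⟶ E) (n₂ : N₂ ⟶ E) (n₃ : N₃ ⟶ E) (h : N ⟶ F.obj E),
      k₁ ≫ h = F.map n₁ ∧ k₂ ≫ h = F.map n₂ ∧ k₃ ≫ h = F.map n₃

def HasIndepHornAmalgamation (F : C ⥤ D) (R : IndependenceRelation D) : Prop :=
  ∀ ⦃M A B C' N₁ N₂ N₃ : C⦄ ⦃N : D⦄ (mA : M ⟶ A) (mB : M ⟶ B) (mC : M ⟶ C')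
    (a₁ : A ⟶ N₁) (b₁ : B ⟶ N₁) (a₂ : A ⟶ N₂) (c₂ : C' ⟶ N₂) (b₃ : B ⟶ N₃) (c₃ : C' ⟶ N₃)
    (kA : F.obj A ⟶ N) (k₃ : F.obj N₃ ⟶ N),
    R.IsIndepHorn (F.map mA) (F.map mB) (F.map mC) (F.map a₁) (F.map b₁) (F.map a₂) (F.map c₂)
      (F.map b₃) (F.map c₃) →
    R.indep (F.map mA) (F.map (mB ≫ b₃)) kA k₃ →
    ∃ (E : C) (aE : A ⟶ E) (n₃ : N₃ ⟶ E) (h : N ⟶ F.obj E),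
      IsTwoCompletion F kA k₃ aE n₃ h ∧
      CanAmalgamate a₁ b₁ aE (b₃ ≫ n₃) ∧ CanAmalgamate a₂ c₂ aE (c₃ ≫ n₃)

end Functors

/-- A reduct functor between AECats: faithful and preserving directed colimits. -/
structure IsReductFunctor {C : Type u₁} [Category.{v} C] {D : Type u₂} [Category.{v} D]
    (F : C ⥤ D) : Prop where
  source : IsAECat C
  target : IsAECat D
  faithful : F.Faithful
  preservesDirectedColimits : PreservesDirectedColimits F

end IndepLift

/-! Invariance, monotonicity, transitivity and symmetry pass to the lift by applying `F`. Existence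
comes from 2-completions, faithfulness giving commutativity in `C`. Uniqueness lifts when `F`
reflects amalgamation of squares.

The analytic content is union and accessibility. The independent squares of the lift are the
preimage of those of `R` under `F.mapArrow`, so the category in question is a pullback of `Arrow C`
and the category of `R`-independent squares over `Arrow D`. Union for `R` says that its squares are
closed under directed colimits taken in `Arrow D`, and this closure pulls back. For accessibility
(`isAccessibleCategory_wide`), present an object of `Arrow C` and its image as directed colimits of
generators, the latter inside the category of independent squares. Take a regular uncountable `κ`
making all generators involved presentable. A back-and-forth of length ω
(`exists_iso_smallDirected`) finds cofinally many `κ`-small directed subdiagrams of the first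
presentation whose colimits have the same image as subcolimits of the second. The inclusions of
these colimits are therefore independent, and they exhibit the object as a `κ`-filtered colimit of
`κ`-presentable objects by independent squares.

The amalgamation clauses rest on `exists_of_canAmalgamate`: it is enough to amalgamate the squares
of `N₁` and `N₂`, separately, with an independent square of `A` and `N₃`. Uniqueness or horn
amalgamation supplies this directly. In the simple case with 3-completions, `N₁` and `N₂` are
replaced by the joins `A ∨ B` and `A ∨ C`; base monotonicity makes the resulting cube independent,
so that it can be completed, and the original vertices are glued back by existence. Strong
3-amalgamation lifts face by face. -/

namespace IndepLift

/-! ### Small directed subsets of a directed poset. -/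

/-- The nonempty directed subsets of a poset whose cardinality is less than `κ`. -/
def SmallDirected (I : Type v) [PartialOrder I] (κ : Cardinal.{v}) : Type v :=
  {s : Set I // s.Nonempty ∧ DirectedOn (· ≤ ·) s ∧ HasCardinalLT s κ}

namespace SmallDirected

variable {I : Type v} [PartialOrder I] {κ : Cardinal.{v}}

instance : PartialOrder (SmallDirected I κ) := inferInstanceAs (PartialOrder (Subtype _))

instance (s : SmallDirected I κ) : Nonempty s.1 := s.2.1.to_subtype

instance (s : SmallDirected I κ) : IsDirectedOrder s.1 := ⟨s.2.2.1.directed_val⟩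

theorem hasCardinalLT_arrow [Fact κ.IsRegular] (s : SmallDirected I κ) :
    HasCardinalLT (Arrow s.1) κ :=
  (hasCardinalLT_prod (Cardinal.IsRegular.aleph0_le Fact.out) s.2.2.2 s.2.2.2).of_injective
    (fun f : Arrow s.1 => (f.left, f.right)) (by
      rintro ⟨a, b, f⟩ ⟨a', b', f'⟩ h
      obtain ⟨rfl, rfl⟩ := Prod.mk.inj h
      obtain rfl : f = f' := Subsingleton.elim _ _
      rfl)

/-- Every element of a directed poset lies in a small directed subset. -/
def singleton [Fact κ.IsRegular] (i : I) : SmallDirected I κ :=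
  ⟨{i}, ⟨i, rfl⟩, directedOn_singleton i,
    hasCardinalLT_of_finite _ _ (Cardinal.IsRegular.aleph0_le Fact.out)⟩

def pair [Fact κ.IsRegular] {i j : I} (h : i ≤ j) : SmallDirected I κ :=
  ⟨{i, j}, ⟨i, by simp⟩, directedOn_pair h,
    hasCardinalLT_of_finite _ _ (Cardinal.IsRegular.aleph0_le Fact.out)⟩

theorem hasCardinalLT_nat (hκ : Cardinal.aleph0 < κ) : HasCardinalLT ℕ κ := by
  simpa [HasCardinalLT] using hκ

/-- The union of an increasing sequence of small directed subsets. -/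
def union [Fact κ.IsRegular] (hκ : Cardinal.aleph0 < κ) (s : ℕ → SmallDirected I κ)
    (hs : Monotone s) : SmallDirected I κ :=
  ⟨⋃ n, (s n).1, by
    obtain ⟨i, hi⟩ := (s 0).2.1
    exact ⟨i, Set.mem_iUnion.2 ⟨0, hi⟩⟩,
    Set.directedOn_iUnion (directed_of_isDirected_le fun _ _ h => hs h) fun n => (s n).2.2.1,
    hasCardinalLT_iUnion _ (hasCardinalLT_nat hκ) fun n => (s n).2.2.2⟩

theorem le_union [Fact κ.IsRegular] (hκ : Cardinal.aleph0 < κ) (s : ℕ → SmallDirected I κ)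
    (hs : Monotone s) (n : ℕ) : s n ≤ union hκ s hs :=
  Set.subset_iUnion (fun n => (s n).1) n

/-- Close `S` under a choice of upper bounds in ω steps. Each step keeps the size below `κ`, and so
does the countable union because `κ` is regular and uncountable. -/
theorem exists_superset [IsDirectedOrder I] [Nonempty I] [Fact κ.IsRegular]
    (hκ : Cardinal.aleph0 < κ) (S : Set I) (hS : HasCardinalLT S κ) :
    ∃ s : SmallDirected I κ, S ⊆ s.1 := by
  choose ub hub using fun p : I × I => exists_ge_ge p.1 p.2
  obtain ⟨i₀⟩ := ‹Nonempty I›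
  have hκ₀ : Cardinal.aleph0 ≤ κ := hκ.le
  let step (T : Set I) : Set I := T ∪ ub '' (T ×ˢ T)
  let T (n : ℕ) : Set I := step^[n] (S ∪ {i₀})
  have hT (n : ℕ) : T (n + 1) = step (T n) := Function.iterate_succ_apply' _ _ _
  have hmono : Monotone T := monotone_nat_of_le_succ fun n => by
    rw [hT]
    exact Set.subset_union_left
  have hcard (n : ℕ) : HasCardinalLT (T n) κ := by
    induction n with
    | zero => exact hasCardinalLT_union hκ₀ hS (hasCardinalLT_of_finite _ _ hκ₀)
    | succ n ih =>
      rw [hT]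
      refine hasCardinalLT_union hκ₀ ih ?_
      have := (hasCardinalLT_iff_of_equiv (Equiv.Set.prod (T n) (T n)) κ).2
        (hasCardinalLT_prod hκ₀ ih ih)
      exact this.of_surjective (fun x => ⟨ub x.1, Set.mem_image_of_mem _ x.2⟩)
        (by rintro ⟨_, x, hx, rfl⟩; exact ⟨⟨x, hx⟩, rfl⟩)
  refine ⟨⟨⋃ n, T n, ⟨i₀, Set.mem_iUnion.2 ⟨0, Or.inr rfl⟩⟩, ?_,
    hasCardinalLT_iUnion _ (hasCardinalLT_nat hκ) hcard⟩, fun i hi =>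
      Set.mem_iUnion.2 ⟨0, Or.inl hi⟩⟩
  intro x hx y hy
  obtain ⟨n, hn⟩ := Set.mem_iUnion.1 hx
  obtain ⟨m, hm⟩ := Set.mem_iUnion.1 hy
  -- Both elements lie in stage `max n m`, so their chosen bound appears one stage later.
  refine ⟨ub (x, y), Set.mem_iUnion.2 ⟨max n m + 1, ?_⟩, (hub (x, y)).1, (hub (x, y)).2⟩
  rw [hT]
  exact Or.inr ⟨(x, y), ⟨hmono (le_max_left n m) hn, hmono (le_max_right n m) hm⟩, rfl⟩

theorem isCardinalFiltered [IsDirectedOrder I] [Nonempty I] [Fact κ.IsRegular]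
    (hκ : Cardinal.aleph0 < κ) : IsCardinalFiltered (SmallDirected I κ) κ :=
  isCardinalFiltered_preorder _ _ fun K s hK => by
    obtain ⟨t, ht⟩ := exists_superset hκ (⋃ k, (s k).1)
      (hasCardinalLT_iUnion _ ((hasCardinalLT_iff_cardinal_mk_lt K κ).2 hK) fun k => (s k).2.2.2)
    exact ⟨t, fun k => (Set.subset_iUnion (fun k => (s k).1) k).trans ht⟩

/-! ### Colimits of a diagram over small directed subsets of its index. -/

variable {E : Type u} [Category.{v} E]

/-- The restriction of a diagram to a subset of its index poset. -/
abbrev restrict (X : I ⥤ E) (s : Set I) : s ⥤ E where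
  obj i := X.obj i.1
  map {i j} f := X.map (homOfLE (leOfHom f) : i.1 ⟶ j.1)
  map_id i := X.map_id i.1
  map_comp _ _ := X.map_comp _ _

theorem hasColimit_restrict (hE : HasDirectedColimits E) (X : I ⥤ E) (s : SmallDirected I κ) :
    HasColimit (restrict X s.1) :=
  have := hE s.1
  inferInstance

section

variable (hE : HasDirectedColimits E) (X : I ⥤ E)

/-- The colimit of a diagram over a small directed subset of its index poset. -/
noncomputable def obj (s : SmallDirected I κ) : E :=
  haveI := hasColimit_restrict hE X s
  colimit (restrict X s.1)

/-- The inclusion into the colimit over a small directed subset. -/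
noncomputable def ι (s : SmallDirected I κ) (i : I) (hi : i ∈ s.1) : X.obj i ⟶ obj hE X s :=
  haveI := hasColimit_restrict hE X s
  colimit.ι (restrict X s.1) ⟨i, hi⟩

theorem map_ι (s : SmallDirected I κ) {i j : I} (f : i ⟶ j) (hi : i ∈ s.1) (hj : j ∈ s.1) :
    X.map f ≫ ι hE X s j hj = ι hE X s i hi := by
  have := hasColimit_restrict hE X s
  let f' : (⟨i, hi⟩ : s.1) ⟶ ⟨j, hj⟩ := homOfLE (leOfHom f)
  exact colimit.w (restrict X s.1) f'

/-- The colimit cocone over a small directed subset. -/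
noncomputable abbrev cocone (s : SmallDirected I κ) : Cocone (restrict X s.1) where
  pt := obj hE X s
  ι.app i := ι hE X s i.1 i.2
  ι.naturality i j _ := (map_ι hE X s _ i.2 j.2).trans (Category.comp_id _).symm

noncomputable def isColimitCocone (s : SmallDirected I κ) : IsColimit (cocone hE X s) :=
  haveI := hasColimit_restrict hE X s
  colimit.isColimit (restrict X s.1)

theorem hom_ext {s : SmallDirected I κ} {W : E} {f g : obj hE X s ⟶ W}
    (h : ∀ i hi, ι hE X s i hi ≫ f = ι hE X s i hi ≫ g) : f = g :=
  (isColimitCocone hE X s).hom_ext fun i => h i.1 i.2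

theorem exists_desc (s : SmallDirected I κ) {W : E} (l : ∀ i ∈ s.1, X.obj i ⟶ W)
    (hl : ∀ i (hi : i ∈ s.1) j (hj : j ∈ s.1) (f : i ⟶ j), X.map f ≫ l j hj = l i hi) :
    ∃ d : obj hE X s ⟶ W, ∀ i hi, ι hE X s i hi ≫ d = l i hi :=
  let c : Cocone (restrict X s.1) :=
    { pt := W
      ι.app i := l i.1 i.2
      ι.naturality i j _ := (hl i.1 i.2 j.1 j.2 _).trans (Category.comp_id _).symm }
  ⟨(isColimitCocone hE X s).desc c, fun i hi => (isColimitCocone hE X s).fac c ⟨i, hi⟩⟩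

theorem exists_map {s t : SmallDirected I κ} (h : s ≤ t) :
    ∃ d : obj hE X s ⟶ obj hE X t, ∀ i hi, ι hE X s i hi ≫ d = ι hE X t i (h hi) :=
  exists_desc hE X s (fun i hi => ι hE X t i (h hi)) fun _ _ _ _ f => map_ι hE X t f _ _

noncomputable def map {s t : SmallDirected I κ} (h : s ≤ t) : obj hE X s ⟶ obj hE X t :=
  (exists_map hE X h).choose

theorem ι_map {s t : SmallDirected I κ} (h : s ≤ t) (i : I) (hi : i ∈ s.1) :
    ι hE X s i hi ≫ map hE X h = ι hE X t i (h hi) :=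
  (exists_map hE X h).choose_spec i hi

/-- The colimits of a diagram over the small directed subsets of its index poset. -/
noncomputable abbrev colim (κ : Cardinal.{v}) : SmallDirected I κ ⥤ E where
  obj s := obj hE X s
  map h := map hE X (leOfHom h)
  map_id s := hom_ext hE X fun i hi => by rw [ι_map, Category.comp_id]
  map_comp _ _ := hom_ext hE X fun i hi => by rw [ι_map, ← Category.assoc, ι_map, ι_map]

variable {X}

theorem exists_toPt (c : Cocone X) (s : SmallDirected I κ) :
    ∃ d : obj hE X s ⟶ c.pt, ∀ i hi, ι hE X s i hi ≫ d = c.ι.app i :=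
  exists_desc hE X s (fun i _ => c.ι.app i) fun _ _ _ _ f => c.w f

noncomputable def toPt (c : Cocone X) (s : SmallDirected I κ) : obj hE X s ⟶ c.pt :=
  (exists_toPt hE c s).choose

theorem ι_toPt (c : Cocone X) (s : SmallDirected I κ) (i : I) (hi : i ∈ s.1) :
    ι hE X s i hi ≫ toPt hE c s = c.ι.app i :=
  (exists_toPt hE c s).choose_spec i hi

theorem map_toPt (c : Cocone X) {s t : SmallDirected I κ} (h : s ≤ t) :
    map hE X h ≫ toPt hE c t = toPt hE c s :=
  hom_ext hE X fun i hi => by rw [← Category.assoc, ι_map, ι_toPt, ι_toPt]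

/-- A cocone on a diagram induces one on its small directed subcolimits. -/
noncomputable abbrev colimCocone (κ : Cardinal.{v}) (c : Cocone X) : Cocone (colim hE X κ) where
  pt := c.pt
  ι.app s := toPt hE c s
  ι.naturality _ _ _ := (map_toPt hE c _).trans (Category.comp_id _).symm

/-- A cocone on the subcolimits is determined by its values on singletons; these form a cocone on
`X`, because for `i ≤ j` both can be compared inside the directed subset `{i, j}`. A directed
colimit thus becomes an iterated one whose outer index is `κ`-filtered when `κ` is uncountable. -/
noncomputable def isColimitColimCocone [Fact κ.IsRegular] {c : Cocone X} (hc : IsColimit c) :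
    IsColimit (colimCocone hE κ c) := by
  have key (d : Cocone (colim hE X κ)) (i : I) (s t : SmallDirected I κ) (h : s ≤ t)
      (hi : i ∈ s.1) : ι hE X s i hi ≫ d.ι.app s = ι hE X t i (h hi) ≫ d.ι.app t := by
    have h₁ : map hE X h ≫ d.ι.app t = d.ι.app s := d.w (homOfLE h)
    rw [← h₁, ← Category.assoc]
    exact congrArg (· ≫ d.ι.app t) (ι_map hE X h i hi)
  let pre (d : Cocone (colim hE X κ)) : Cocone X :=
    { pt := d.pt
      ι.app i := ι hE X (singleton i) i rfl ≫ d.ι.app _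
      ι.naturality i j f := by
        have h₁ : singleton i ≤ pair (κ := κ) (leOfHom f) := by
          rintro _ rfl; exact Or.inl rfl
        have h₂ : singleton j ≤ pair (κ := κ) (leOfHom f) := by
          rintro _ rfl; exact Or.inr rfl
        rw [key d i _ _ h₁ rfl, key d j _ _ h₂ rfl, ← Category.assoc]
        exact (congrArg (· ≫ d.ι.app _) (map_ι hE X _ f (h₁ rfl) (h₂ rfl))).trans
          (Category.comp_id _).symm }
  have hpre (d : Cocone (colim hE X κ)) (s : SmallDirected I κ) (i : I) (hi : i ∈ s.1) :
      (pre d).ι.app i = ι hE X s i hi ≫ d.ι.app s :=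
    key d i (singleton i) s (by rintro _ rfl; exact hi) rfl
  exact
    { desc d := hc.desc (pre d)
      fac d s := by
        refine hom_ext hE X fun i hi => ?_
        have h₁ := hc.fac (pre d) i
        rw [← hpre d s i hi, ← h₁, ← ι_toPt hE c s i hi]
        exact (Category.assoc _ _ _).symm
      uniq d m hm := by
        refine hc.hom_ext fun i => ?_
        rw [hc.fac, hpre d (singleton i) i rfl, ← hm, ← ι_toPt hE c (singleton (κ := κ) i) i rfl]
        exact Category.assoc _ _ _ }

variable {E' : Type u₂} [Category.{v} E'] {Φ : E ⥤ E'}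

theorem isCardinalPresentable_obj [Fact κ.IsRegular] (hΦ : PreservesDirectedColimits Φ)
    (hX : ∀ i, IsCardinalPresentable (Φ.obj (X.obj i)) κ) (s : SmallDirected I κ) :
    IsCardinalPresentable (Φ.obj (obj hE X s)) κ := by
  have := hΦ s.1
  have : ∀ k, IsCardinalPresentable ((restrict X s.1 ⋙ Φ).obj k) κ := fun k => hX k.1
  exact isCardinalPresentable_of_isColimit _
    (isColimitOfPreserves Φ (isColimitCocone hE X s)) κ s.hasCardinalLT_arrow

/-- The factorizations are unique since `g` is mono, hence compatible, and they glue because `Φ`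
preserves the colimit over `s`. -/
theorem exists_factor (hΦ : PreservesDirectedColimits Φ) (c : Cocone X) (s : SmallDirected I κ)
    {W : E'} (g : W ⟶ Φ.obj c.pt) [Mono g]
    (h : ∀ i ∈ s.1, ∃ l : Φ.obj (X.obj i) ⟶ W, l ≫ g = Φ.map (c.ι.app i)) :
    ∃ l : Φ.obj (obj hE X s) ⟶ W, l ≫ g = Φ.map (toPt hE c s) := by
  have := hΦ s.1
  choose l hl using h
  have hc := isColimitOfPreserves Φ (isColimitCocone hE X s)
  let d : Cocone (restrict X s.1 ⋙ Φ) :=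
    { pt := W
      ι.app i := l i.1 i.2
      ι.naturality i j f := by
        rw [← cancel_mono g]
        have := c.w (homOfLE (leOfHom f) : i.1 ⟶ j.1)
        simp only [Functor.comp_map, Category.assoc, hl, ← Φ.map_comp, this,
          Functor.const_obj_map, Functor.const_obj_obj, Category.id_comp] }
  refine ⟨hc.desc d, hc.hom_ext fun i => ?_⟩
  have h₁ : Φ.map (ι hE X s i.1 i.2) ≫ hc.desc d = l i.1 i.2 := hc.fac d i
  change Φ.map (ι hE X s i.1 i.2) ≫ hc.desc d ≫ g = Φ.map (ι hE X s i.1 i.2) ≫ _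
  rw [← Category.assoc, h₁, hl, ← Φ.map_comp, ι_toPt]

end

end SmallDirected

/-! ### Cofinal subsets, and passage between directed posets and filtered categories. -/

section Cofinal

variable {P : Type v} [PartialOrder P] {T : P → Prop} {κ : Cardinal.{v}} [Fact κ.IsRegular]

theorem isCardinalFiltered_subtype [IsCardinalFiltered P κ] (hT : ∀ p, ∃ t, T t ∧ p ≤ t) :
    IsCardinalFiltered (Subtype T) κ :=
  isCardinalFiltered_preorder _ _ fun K s hK => by
    have hK' := (hasCardinalLT_iff_cardinal_mk_lt K κ).2 hK
    obtain ⟨t, ht, h⟩ := hT (IsCardinalFiltered.max (fun k => (s k).1) hK')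
    exact ⟨⟨t, ht⟩, fun k => (leOfHom (IsCardinalFiltered.toMax (fun k => (s k).1) hK' k)).trans h⟩

theorem final_subtype [IsCardinalFiltered P κ] (hT : ∀ p, ∃ t, T t ∧ p ≤ t) :
    (Subtype.mono_coe T).functor.Final := by
  have := isFiltered_of_isCardinalFiltered P κ
  have : (Subtype.mono_coe T).functor.Full := ⟨fun f => ⟨homOfLE (leOfHom f), rfl⟩⟩
  have : (Subtype.mono_coe T).functor.Faithful := ⟨fun _ => Subsingleton.elim _ _⟩
  refine Functor.final_of_exists_of_isFiltered_of_fullyFaithful _ fun p => ?_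
  obtain ⟨t, ht, h⟩ := hT p
  exact ⟨⟨t, ht⟩, ⟨homOfLE h⟩⟩

end Cofinal

variable {E : Type u₁} [Category.{v} E] {E' : Type u₂} [Category.{v} E']

theorem isDirectedOrder_of_isCardinalFiltered (J : Type v) [PartialOrder J] (κ : Cardinal.{v})
    [Fact κ.IsRegular] [IsCardinalFiltered J κ] : IsDirectedOrder J :=
  have := isFiltered_of_isCardinalFiltered J κ
  IsFiltered.isDirectedOrder J

theorem HasDirectedColimits.hasCardinalFilteredColimits (h : HasDirectedColimits E)
    (κ : Cardinal.{v}) [Fact κ.IsRegular] : HasCardinalFilteredColimits E κ where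
  hasColimitsOfShape J _ _ := by
    obtain ⟨α, _, _, G, _⟩ := IsCardinalFiltered.exists_cardinal_directed J κ
    have := isDirectedOrder_of_isCardinalFiltered α κ
    have := IsCardinalFiltered.nonempty α κ
    have := h α
    exact Functor.Final.hasColimitsOfShape_of_final G

theorem PreservesDirectedColimits.isCardinalAccessible {Φ : E ⥤ E'}
    (h : PreservesDirectedColimits Φ) (κ : Cardinal.{v}) [Fact κ.IsRegular] :
    Φ.IsCardinalAccessible κ where
  preservesColimitOfShape J _ _ := by
    obtain ⟨α, _, _, G, _⟩ := IsCardinalFiltered.exists_cardinal_directed J κ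
    have := isDirectedOrder_of_isCardinalFiltered α κ
    have := IsCardinalFiltered.nonempty α κ
    have := h α
    exact Functor.Final.preservesColimitsOfShape_of_final G Φ

/-- In a category all of whose morphisms are monomorphisms, an object is presentable as soon as
the morphisms from it into filtered colimits factor through the diagram. -/
theorem isCardinalPresentable_of_mono (hE : ∀ ⦃X Y : E⦄ (f : X ⟶ Y), Mono f) {x : E}
    {κ : Cardinal.{v}} [Fact κ.IsRegular]
    (h : ∀ (J : Type v) [SmallCategory J] [IsCardinalFiltered J κ] (H : J ⥤ E) (c : Cocone H)
      (_ : IsColimit c) (f : x ⟶ c.pt), ∃ (j : J) (g : x ⟶ H.obj j), g ≫ c.ι.app j = f) :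
    IsCardinalPresentable x κ where
  preservesColimitOfShape J _ _ :=
    have := isFiltered_of_isCardinalFiltered J κ
    { preservesColimit := fun {H} =>
        { preserves := fun {c} hc => ⟨Types.FilteredColimit.isColimitOf' _ _
            (fun f => by
              obtain ⟨j, g, hg⟩ := h J H c hc f
              exact ⟨j, g, hg.symm⟩)
            -- Two maps identified in the colimit are already equal, since the leg is mono; no later
            -- stage is needed.
            (fun j f g hfg => by
              have : Mono (c.ι.app j) := hE _
              exact ⟨j, 𝟙 j, congrArg (· ≫ H.map (𝟙 j)) ((cancel_mono (c.ι.app j)).1 hfg)⟩)⟩ } }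

/-! ### Directed colimits and presentable objects in wide subcategories. -/

section Wide

/-- In the wide subcategory of `W`, directed colimits are computed in the ambient category. -/
def ClosedUnderDirectedColimits (W : MorphismProperty E) [W.IsMultiplicative] : Prop :=
  ∀ (J : Type v) [PartialOrder J] [IsDirectedOrder J] [Nonempty J] (H : J ⥤ WideSubcategory W)
    (c : Cocone (H ⋙ wideSubcategoryInclusion W)), IsColimit c →
    (∀ j, W (c.ι.app j)) ∧ ∀ (y : E) (m : c.pt ⟶ y), (∀ j, W (c.ι.app j ≫ m)) → W m

variable {V : MorphismProperty E'} [V.IsMultiplicative]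
  {W : MorphismProperty E} [W.IsMultiplicative]

/-- The colimit taken in the wide subcategory is also one in `E'`, so every other colimit cocone
differs from it by an isomorphism, which lies in `V`. This form of union, unlike existence and
preservation of colimits, pulls back along functors. -/
theorem closedUnderDirectedColimits_of_preserves
    (hV : HasDirectedColimits (WideSubcategory V))
    (hV' : PreservesDirectedColimits (wideSubcategoryInclusion V))
    (hiso : ∀ ⦃X Y : E'⦄ (f : X ⟶ Y), IsIso f → V f) : ClosedUnderDirectedColimits V := by
  intro J _ _ _ H c hc
  have := hV J
  have := hV' J
  let e := colimit.cocone H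
  have he := isColimitOfPreserves (wideSubcategoryInclusion V) (colimit.isColimit H)
  let i : (colimit H).obj ≅ c.pt := he.coconePointUniqueUpToIso hc
  have hi (j : J) : (e.ι.app j).1 ≫ i.hom = c.ι.app j :=
    he.comp_coconePointUniqueUpToIso_hom hc j
  refine ⟨fun j => ?_, fun y m hm => ?_⟩
  · rw [← hi j]
    exact V.comp_mem _ _ (e.ι.app j).2 (hiso _ inferInstance)
  · let d : Cocone H :=
      { pt := ⟨y⟩
        ι :=
          { app := fun j => ⟨c.ι.app j ≫ m, hm j⟩
            naturality := fun j j' f => by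
              ext
              exact (c.extend m).ι.naturality f } }
    have h : m = i.inv ≫ ((colimit.isColimit H).desc d).1 := by
      refine hc.hom_ext fun j => ?_
      have h₁ : (e.ι.app j).1 ≫ ((colimit.isColimit H).desc d).1 = c.ι.app j ≫ m :=
        congrArg (·.1) ((colimit.isColimit H).fac d j)
      have aux {A B : E'} (f : A ⟶ (colimit H).obj) (g : (colimit H).obj ⟶ B) :
          f ≫ g = (f ≫ i.hom) ≫ i.inv ≫ g := by simp
      rw [← h₁, ← hi j]
      exact aux _ _
    rw [h]
    exact V.comp_mem _ _ (hiso _ inferInstance) ((colimit.isColimit H).desc d).2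

theorem ClosedUnderDirectedColimits.of_functor {Φ : E ⥤ E'} (hV : ClosedUnderDirectedColimits V)
    (hΦ : PreservesDirectedColimits Φ) (hW : ∀ ⦃X Y : E⦄ (f : X ⟶ Y), W f ↔ V (Φ.map f)) :
    ClosedUnderDirectedColimits W := by
  intro J _ _ _ H c hc
  have := hΦ J
  let H' : J ⥤ WideSubcategory V :=
    { obj := fun j => ⟨Φ.obj (H.obj j).obj⟩
      map := fun f => ⟨Φ.map (H.map f).1, (hW _).1 (H.map f).2⟩
      map_id := fun j => by ext; simp
      map_comp := fun f g => by ext; simp }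
  obtain ⟨h₁, h₂⟩ := hV J H' (Φ.mapCocone c) (isColimitOfPreserves Φ hc)
  refine ⟨fun j => (hW _).2 (h₁ j), fun y m hm => (hW _).2 (h₂ _ _ fun j => ?_)⟩
  have := (hW _).1 (hm j)
  rwa [Φ.map_comp] at this

/-- The lift of a colimit cocone to the wide subcategory. -/
def wideCocone {J : Type v} [PartialOrder J] {H : J ⥤ WideSubcategory W}
    (c : Cocone (H ⋙ wideSubcategoryInclusion W)) (h : ∀ j, W (c.ι.app j)) : Cocone H where
  pt := ⟨c.pt⟩
  ι :=
    { app := fun j => ⟨c.ι.app j, h j⟩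
      naturality := fun j j' f => by
        ext
        exact c.ι.naturality f }

def isColimitWideCocone {J : Type v} [PartialOrder J] {H : J ⥤ WideSubcategory W}
    {c : Cocone (H ⋙ wideSubcategoryInclusion W)} (hc : IsColimit c) (h : ∀ j, W (c.ι.app j))
    (h' : ∀ (y : E) (m : c.pt ⟶ y), (∀ j, W (c.ι.app j ≫ m)) → W m) :
    IsColimit (wideCocone c h) where
  desc d := ⟨hc.desc ((wideSubcategoryInclusion W).mapCocone d), h' _ _ fun j => by
    have h₁ : c.ι.app j ≫ hc.desc ((wideSubcategoryInclusion W).mapCocone d) = (d.ι.app j).1 :=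
      hc.fac ((wideSubcategoryInclusion W).mapCocone d) j
    exact h₁ ▸ (d.ι.app j).2⟩
  fac d j := by
    ext
    exact hc.fac ((wideSubcategoryInclusion W).mapCocone d) j
  uniq d m hm := by
    ext
    exact hc.uniq ((wideSubcategoryInclusion W).mapCocone d) m.1 fun j => congrArg (·.1) (hm j)

theorem ClosedUnderDirectedColimits.hasDirectedColimits (hW : ClosedUnderDirectedColimits W)
    (hE : HasDirectedColimits E) : HasDirectedColimits (WideSubcategory W) := fun J _ _ _ =>
  have := hE J
  ⟨fun H =>
    have h := hW J H _ (colimit.isColimit _)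
    ⟨⟨_, isColimitWideCocone (colimit.isColimit _) h.1 h.2⟩⟩⟩

theorem ClosedUnderDirectedColimits.preservesDirectedColimits
    (hW : ClosedUnderDirectedColimits W) (hE : HasDirectedColimits E) :
    PreservesDirectedColimits (wideSubcategoryInclusion W) := fun J _ _ _ =>
  have := hE J
  ⟨fun {H} =>
    have h := hW J H _ (colimit.isColimit _)
    preservesColimit_of_preserves_colimit_cocone
      (isColimitWideCocone (colimit.isColimit _) h.1 h.2)
      ((colimit.isColimit _).ofIsoColimit (Cocone.ext (Iso.refl _) fun _ => Category.comp_id _))⟩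

/-- A map into a colimit factors through a stage in `E`. The factor lies in `W` by left cancellation
`hcoh`, because its composite with a leg does. -/
theorem isCardinalPresentable_wide (hmono : ∀ ⦃X Y : E⦄ (f : X ⟶ Y), Mono f)
    (hW : PreservesDirectedColimits (wideSubcategoryInclusion W))
    (hcoh : ∀ ⦃X Y Z : E⦄ (f : X ⟶ Y) (g : Y ⟶ Z), W (f ≫ g) → W f)
    {x : E} {κ : Cardinal.{v}} [Fact κ.IsRegular] [IsCardinalPresentable x κ] :
    IsCardinalPresentable (⟨x⟩ : WideSubcategory W) κ := by
  refine isCardinalPresentable_of_mono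
    (fun X Y f => (wideSubcategoryInclusion W).mono_of_mono_map (hmono _)) ?_
  intro J _ _ H c hc f
  have := hW.isCardinalAccessible κ
  have := (wideSubcategoryInclusion W).preservesColimitsOfShape_of_isCardinalAccessible κ J
  obtain ⟨j, g, hg⟩ := IsCardinalPresentable.exists_hom_of_isColimit κ
    (isColimitOfPreserves (wideSubcategoryInclusion W) hc) f.1
  change x ⟶ (H.obj j).obj at g
  change g ≫ (c.ι.app j).1 = f.1 at hg
  refine ⟨j, ⟨g, hcoh _ (c.ι.app j).1 ?_⟩, ?_⟩
  · rw [hg]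
    exact f.2
  · ext
    exact hg

end Wide

/-! ### The back-and-forth between two presentations of one object. -/

namespace SmallDirected

theorem exists_factor_of_le {I : Type v} [PartialOrder I] {κ : Cardinal.{v}}
    (hE : HasDirectedColimits E) {Φ : E ⥤ E'} {x : E} (p : ColimitPresentation I x)
    {s t : SmallDirected I κ} (h : s ≤ t) {y : E'} {f : y ⟶ Φ.obj x}
    (hs : ∃ l : y ⟶ Φ.obj (obj hE p.diag s), l ≫ Φ.map (toPt hE p.cocone s) = f) :
    ∃ l : y ⟶ Φ.obj (obj hE p.diag t), l ≫ Φ.map (toPt hE p.cocone t) = f := by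
  obtain ⟨l, hl⟩ := hs
  refine ⟨l ≫ Φ.map (map hE p.diag h), ?_⟩
  rw [Category.assoc, ← Φ.map_comp, map_toPt, hl]

section

variable {I : Type v} [PartialOrder I] [IsDirectedOrder I] [Nonempty I]
  {κ : Cardinal.{v}} [Fact κ.IsRegular]

theorem exists_ge_ge (hκ : Cardinal.aleph0 < κ) (s t : SmallDirected I κ) :
    ∃ r : SmallDirected I κ, s ≤ r ∧ t ≤ r :=
  have := isCardinalFiltered (I := I) hκ
  have := isDirectedOrder_of_isCardinalFiltered (SmallDirected I κ) κ
  _root_.exists_ge_ge s t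

theorem exists_hom_of_isCardinalPresentable (hE : HasDirectedColimits E) {Φ : E ⥤ E'}
    (hΦ : PreservesDirectedColimits Φ) {x : E} (p : ColimitPresentation I x)
    (hκ : Cardinal.aleph0 < κ) {y : E'}
    (hy : IsCardinalPresentable y κ) (f : y ⟶ Φ.obj x) :
    ∃ (s : SmallDirected I κ) (l : y ⟶ Φ.obj (obj hE p.diag s)),
      l ≫ Φ.map (toPt hE p.cocone s) = f := by
  have := isCardinalFiltered (I := I) hκ
  have := hΦ.isCardinalAccessible κ
  have := Φ.preservesColimitsOfShape_of_isCardinalAccessible κ (SmallDirected I κ)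
  exact IsCardinalPresentable.exists_hom_of_isColimit κ
    (isColimitOfPreserves Φ (isColimitColimCocone (κ := κ) hE p.isColimit)) f

end

end SmallDirected

open SmallDirected

/-- Two functors into `E'` preserving directed colimits, and presentations of the same object of
`E'` by objects with presentable images: beyond any pair of small subdiagrams there is a pair
presenting the same subobject. -/
theorem exists_iso_smallDirected {E₁ : Type u} [Category.{v} E₁] {E₂ : Type u₁} [Category.{v} E₂]
    (hmono : ∀ ⦃X Y : E'⦄ (f : X ⟶ Y), Mono f)
    (h₁ : HasDirectedColimits E₁) (h₂ : HasDirectedColimits E₂)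
    {Φ₁ : E₁ ⥤ E'} (hΦ₁ : PreservesDirectedColimits Φ₁)
    {Φ₂ : E₂ ⥤ E'} (hΦ₂ : PreservesDirectedColimits Φ₂)
    {κ : Cardinal.{v}} [Fact κ.IsRegular] (hκ : Cardinal.aleph0 < κ)
    {I : Type v} [PartialOrder I] [IsDirectedOrder I] [Nonempty I]
    {K : Type v} [PartialOrder K] [IsDirectedOrder K] [Nonempty K]
    {x : E₁} {y : E₂} (w : Φ₂.obj y ≅ Φ₁.obj x)
    (p : ColimitPresentation I x) (q : ColimitPresentation K y)
    (hp : ∀ i, IsCardinalPresentable (Φ₁.obj (p.diag.obj i)) κ)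
    (hq : ∀ k, IsCardinalPresentable (Φ₂.obj (q.diag.obj k)) κ) (s₀ : SmallDirected I κ) :
    ∃ (s : SmallDirected I κ) (u : SmallDirected K κ)
      (l : Φ₁.obj (obj h₁ p.diag s) ≅ Φ₂.obj (obj h₂ q.diag u)), s₀ ≤ s ∧
      l.hom ≫ Φ₂.map (toPt h₂ q.cocone u) ≫ w.hom = Φ₁.map (toPt h₁ p.cocone s) := by
  -- One round: a subcolimit on either side is `κ`-presentable in `E'`, so its map to the common
  -- object factors through a larger subcolimit on the other side.
  have step (z : SmallDirected I κ × SmallDirected K κ) :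
      ∃ z' : SmallDirected I κ × SmallDirected K κ, z ≤ z' ∧
        (∃ l : Φ₁.obj (obj h₁ p.diag z.1) ⟶ Φ₂.obj (obj h₂ q.diag z'.2),
          l ≫ Φ₂.map (toPt h₂ q.cocone z'.2) = Φ₁.map (toPt h₁ p.cocone z.1) ≫ w.inv) ∧
        (∃ l : Φ₂.obj (obj h₂ q.diag z.2) ⟶ Φ₁.obj (obj h₁ p.diag z'.1),
          l ≫ Φ₁.map (toPt h₁ p.cocone z'.1) = Φ₂.map (toPt h₂ q.cocone z.2) ≫ w.hom) := by
    obtain ⟨u, hu⟩ := exists_hom_of_isCardinalPresentable h₂ hΦ₂ q hκ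
      (isCardinalPresentable_obj h₁ hΦ₁ hp z.1) (Φ₁.map (toPt h₁ p.cocone z.1) ≫ w.inv)
    obtain ⟨s, hs⟩ := exists_hom_of_isCardinalPresentable h₁ hΦ₁ p hκ
      (isCardinalPresentable_obj h₂ hΦ₂ hq z.2) (Φ₂.map (toPt h₂ q.cocone z.2) ≫ w.hom)
    obtain ⟨s', hs₁, hs₂⟩ := exists_ge_ge hκ z.1 s
    obtain ⟨u', hu₁, hu₂⟩ := exists_ge_ge hκ z.2 u
    exact ⟨(s', u'), ⟨hs₁, hu₁⟩, exists_factor_of_le h₂ q hu₂ hu, exists_factor_of_le h₁ p hs₂ hs⟩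
  choose next hnext hnext₁ hnext₂ using step
  have : Nonempty (SmallDirected K κ) := ⟨SmallDirected.singleton (Classical.arbitrary K)⟩
  let z (n : ℕ) := next^[n] (s₀, Classical.arbitrary _)
  have hz (n : ℕ) : z (n + 1) = next (z n) := Function.iterate_succ_apply' _ _ _
  have hmon : Monotone z := monotone_nat_of_le_succ fun n => by
    rw [hz]
    exact hnext _
  have hs : Monotone fun n => (z n).1 := fun _ _ h => (hmon h).1
  have hu : Monotone fun n => (z n).2 := fun _ _ h => (hmon h).2
  let s := union hκ _ hs
  let u := union hκ _ hu
  have : Mono (Φ₁.map (toPt h₁ p.cocone s)) := hmono _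
  have : Mono (Φ₂.map (toPt h₂ q.cocone u) ≫ w.hom) := hmono _
  -- An element of the union lies in some stage `n`, and stage `n` of one side factors through stage
  -- `n + 1` of the other. Hence each union factors through the other, and monicity makes the two
  -- factorizations inverse.
  obtain ⟨l, hl⟩ := exists_factor h₁ hΦ₁ p.cocone s (Φ₂.map (toPt h₂ q.cocone u) ≫ w.hom)
    fun i hi => by
      obtain ⟨n, hn⟩ := Set.mem_iUnion.1 hi
      have h := hnext₁ (z n)
      rw [← hz] at h
      obtain ⟨l, hl⟩ := exists_factor_of_le h₂ q (le_union hκ _ hu (n + 1)) h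
      refine ⟨Φ₁.map (ι h₁ p.diag (z n).1 i hn) ≫ l, ?_⟩
      rw [← ι_toPt h₁ p.cocone (z n).1 i hn, Φ₁.map_comp, Category.assoc, ← Category.assoc l]
      rw [show l ≫ Φ₂.map (toPt h₂ q.cocone u) = _ from hl]
      simp
  obtain ⟨l', hl'⟩ := exists_factor h₂ hΦ₂ q.cocone u (Φ₁.map (toPt h₁ p.cocone s) ≫ w.inv)
    fun i hi => by
      obtain ⟨n, hn⟩ := Set.mem_iUnion.1 hi
      have h := hnext₂ (z n)
      rw [← hz] at h
      obtain ⟨l, hl⟩ := exists_factor_of_le h₁ p (le_union hκ _ hs (n + 1)) h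
      refine ⟨Φ₂.map (ι h₂ q.diag (z n).2 i hn) ≫ l, ?_⟩
      rw [← ι_toPt h₂ q.cocone (z n).2 i hn, Φ₂.map_comp, Category.assoc, ← Category.assoc l]
      rw [show l ≫ Φ₁.map (toPt h₁ p.cocone s) = _ from hl]
      simp
  refine ⟨s, u, ⟨l, l', ?_, ?_⟩, le_union hκ _ hs 0, hl⟩
  · rw [← cancel_mono (Φ₁.map (toPt h₁ p.cocone s)), Category.assoc, Category.id_comp,
      show l' ≫ Φ₁.map (toPt h₁ p.cocone s) = _ from (w.comp_inv_eq).1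
        ((Category.assoc _ _ _).trans hl')]
    exact hl
  · rw [← cancel_mono (Φ₂.map (toPt h₂ q.cocone u) ≫ w.hom), Category.assoc, Category.id_comp,
      show l ≫ Φ₂.map (toPt h₂ q.cocone u) ≫ w.hom = _ from hl]
    exact (w.comp_inv_eq).1 ((Category.assoc _ _ _).trans hl')


/-! ### Accessibility of a pulled-back wide subcategory. -/

theorem exists_isRegular_forall_le {ι : Type u} [Small.{v} ι] (f : ι → Cardinal.{v}) :
    ∃ κ : Cardinal.{v}, κ.IsRegular ∧ Cardinal.aleph0 < κ ∧ ∀ i, f i ≤ κ := by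
  let a := max Cardinal.aleph0 (⨆ i, f i)
  refine ⟨Order.succ a, Cardinal.isRegular_succ (le_max_left _ _),
    (le_max_left _ _).trans_lt (Order.lt_succ a), fun i => ?_⟩
  have : BddAbove (Set.range f) := Cardinal.bddAbove_of_small
  exact ((le_ciSup this i).trans (le_max_right _ _)).trans (Order.le_succ a)

theorem exists_forall_isCardinalPresentable {ι₁ ι₂ : Type*} [Small.{v} ι₁] [Small.{v} ι₂]
    (x₁ : ι₁ → E) (x₂ : ι₂ → E')
    (h₁ : ∀ i, IsPresentable.{v} (x₁ i)) (h₂ : ∀ i, IsPresentable.{v} (x₂ i)) :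
    ∃ (κ : Cardinal.{v}) (_ : Fact κ.IsRegular), Cardinal.aleph0 < κ ∧
      (∀ i, IsCardinalPresentable (x₁ i) κ) ∧ ∀ i, IsCardinalPresentable (x₂ i) κ := by
  choose c₁ hc₁ hx₁ using fun i => (h₁ i).exists_cardinal
  choose c₂ hc₂ hx₂ using fun i => (h₂ i).exists_cardinal
  obtain ⟨κ, hκ, hκ', h⟩ := exists_isRegular_forall_le (Sum.elim c₁ c₂)
  have : Fact κ.IsRegular := ⟨hκ⟩
  refine ⟨κ, this, hκ', fun i => ?_, fun i => ?_⟩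
  · have : c₁ i ≤ κ := h (Sum.inl i)
    exact isCardinalPresentable_of_le _ this
  · have : c₂ i ≤ κ := h (Sum.inr i)
    exact isCardinalPresentable_of_le _ this

/-- Every object is a directed colimit of objects satisfying `G`. -/
def IsDirectedGenerator (G : ObjectProperty E) : Prop :=
  ∀ x : E, ∃ (J : Type v) (_ : PartialOrder J) (_ : IsDirectedOrder J) (_ : Nonempty J),
    G.colimitsOfShape J x

theorem isDirectedGenerator_of_isCardinalFilteredGenerator {G : ObjectProperty E}
    {κ : Cardinal.{v}} [Fact κ.IsRegular] (h : G.IsCardinalFilteredGenerator κ) :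
    IsDirectedGenerator G := fun x => by
  obtain ⟨J, _, _, ⟨p⟩⟩ := h.exists_colimitsOfShape x
  obtain ⟨α, _, _, F, _⟩ := IsCardinalFiltered.exists_cardinal_directed J κ
  exact ⟨α, _, isDirectedOrder_of_isCardinalFiltered α κ, IsCardinalFiltered.nonempty α κ,
    ⟨p.reindex F⟩⟩

section

variable {V : MorphismProperty E'} [V.IsMultiplicative]
  {W : MorphismProperty E} [W.IsMultiplicative]

theorem essentiallySmall_wide (G : ObjectProperty E) [ObjectProperty.EssentiallySmall.{v} G]
    (hiso : ∀ ⦃X Y : E⦄ (f : X ⟶ Y), IsIso f → W f) :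
    ObjectProperty.EssentiallySmall.{v} (fun x : WideSubcategory W => G x.obj) := by
  obtain ⟨Q, _, hQ, hGQ⟩ := ObjectProperty.EssentiallySmall.exists_small_le G
  refine ⟨fun x => Q x.obj, ?_, fun x hx => ?_⟩
  · exact small_of_injective (β := Subtype Q) (f := fun x => ⟨x.1.obj, x.2⟩) fun x y h => by
      obtain ⟨⟨x⟩, hx⟩ := x
      obtain ⟨⟨y⟩, hy⟩ := y
      obtain rfl : x = y := congrArg Subtype.val h
      rfl
  · obtain ⟨y, hy, ⟨e⟩⟩ := hGQ _ hx
    exact ⟨⟨y⟩, hy, ⟨WideSubcategory.isoMk e (hiso _ inferInstance) (hiso _ inferInstance)⟩⟩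

/-- A pullback of accessible categories with directed colimits and monomorphisms. -/
theorem isAccessibleCategory_wide {Φ : E ⥤ E'}
    (hmono : ∀ ⦃X Y : E⦄ (f : X ⟶ Y), Mono f) (hmono' : ∀ ⦃X Y : E'⦄ (f : X ⟶ Y), Mono f)
    (hE : HasDirectedColimits E) (hΦ : PreservesDirectedColimits Φ)
    (hV : HasDirectedColimits (WideSubcategory V))
    (hV' : PreservesDirectedColimits (wideSubcategoryInclusion V))
    (hVa : IsAccessibleCategory.{v} (WideSubcategory V))
    (hiso : ∀ ⦃X Y : E'⦄ (f : X ⟶ Y), IsIso f → V f)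
    (hcoh : ∀ ⦃X Y Z : E'⦄ (f : X ⟶ Y) (g : Y ⟶ Z), V (f ≫ g) → V f)
    (hW : ∀ ⦃X Y : E⦄ (f : X ⟶ Y), W f ↔ V (Φ.map f))
    (hpres : ∀ x : E, IsPresentable.{v} x) (hpres' : ∀ x : E', IsPresentable.{v} x)
    {G : ObjectProperty E} [ObjectProperty.EssentiallySmall.{v} G] (hG : IsDirectedGenerator G) :
    IsAccessibleCategory.{v} (WideSubcategory W) := by
  have hWcl : ClosedUnderDirectedColimits W :=
    (closedUnderDirectedColimits_of_preserves hV hV' hiso).of_functor hΦ hW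
  have hWiso : ∀ ⦃X Y : E⦄ (f : X ⟶ Y), IsIso f → W f := fun X Y f _ =>
    (hW f).2 (hiso _ inferInstance)
  have hWcoh : ∀ ⦃X Y Z : E⦄ (f : X ⟶ Y) (g : Y ⟶ Z), W (f ≫ g) → W f := fun X Y Z f g h =>
    (hW f).2 (hcoh _ (Φ.map g) (by rw [← Φ.map_comp]; exact (hW _).1 h))
  obtain ⟨Q, _, hQ, hGQ⟩ := ObjectProperty.EssentiallySmall.exists_small_le G
  obtain ⟨κ₀, _, _⟩ := IsAccessibleCategory.exists_cardinal (WideSubcategory V)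
  obtain ⟨Q', _, hQ'⟩ := HasCardinalFilteredGenerator.exists_small_generator (WideSubcategory V) κ₀
  -- `κ₀` serves only to produce the small set `Q'`. The new `κ` is chosen so that the generators in
  -- `Q`, their images, and the objects underlying `Q'` are all `κ`-presentable.
  obtain ⟨κ, _, hκ, hκ₁, hκ₂⟩ := exists_forall_isCardinalPresentable
    (fun x : Subtype Q => x.1)
    (Sum.elim (fun x : Subtype Q => Φ.obj x.1) fun z : Subtype Q' => z.1.obj)
    (fun _ => hpres _) (fun _ => hpres' _)
  refine ⟨κ, inferInstance, ?_⟩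
  have := (hWcl.hasDirectedColimits hE).hasCardinalFilteredColimits κ
  have := essentiallySmall_wide (W := W) (Q.colimitsCardinalClosure κ) hWiso
  have hclosure : Q.colimitsCardinalClosure κ ≤ isCardinalPresentable E κ :=
    Q.colimitsCardinalClosure_le κ
      (fun J _ hJ => isClosedUnderColimitsOfShape_isCardinalPresentable.{v} E hJ)
      fun x hx => hκ₁ ⟨x, hx⟩
  -- The generators are closed under `κ`-small colimits in order to contain all the subcolimits used
  -- below.
  have hgen : ObjectProperty.IsCardinalFilteredGenerator
      (fun x : WideSubcategory W => Q.colimitsCardinalClosure κ x.obj) κ :=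
    { le_isCardinalPresentable := fun x hx =>
        have : IsCardinalPresentable x.obj κ := hclosure _ hx
        isCardinalPresentable_wide hmono (hWcl.preservesDirectedColimits hE) hWcoh
      exists_colimitsOfShape := fun x => by
        obtain ⟨I, _, _, _, hp⟩ := hG x.obj
        replace hp : Q.colimitsOfShape I x.obj := by
          rw [← ObjectProperty.colimitsOfShape_isoClosure]
          exact ObjectProperty.colimitsOfShape_monotone I hGQ _ hp
        obtain ⟨p⟩ := hp
        obtain ⟨K, _, _, _, ⟨q⟩⟩ := isDirectedGenerator_of_isCardinalFilteredGenerator hQ'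
          (⟨Φ.obj x.obj⟩ : WideSubcategory V)
        -- The good subsets are those whose subcolimit includes into `x` by a map of `W`. They are
        -- cofinal: for the `s` found by back-and-forth, the image of this inclusion is, up to
        -- isomorphism, a colimit leg of the wide subcategory of `V`.
        let T (s : SmallDirected I κ) : Prop := W (toPt hE p.cocone s)
        have hT (s₀ : SmallDirected I κ) : ∃ s, T s ∧ s₀ ≤ s := by
          obtain ⟨s, u, l, hs, h⟩ := exists_iso_smallDirected hmono' hE hV hΦ hV' hκ
            (Iso.refl (Φ.obj x.obj)) p.toColimitPresentation q.toColimitPresentation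
            (fun i => hκ₂ (Sum.inl ⟨_, p.prop_diag_obj i⟩))
            (fun k => hκ₂ (Sum.inr ⟨_, q.prop_diag_obj k⟩)) s₀
          refine ⟨s, (hW _).2 ?_, hs⟩
          rw [← h]
          refine V.comp_mem _ _ (hiso _ inferInstance) (V.comp_mem _ _ ?_ (hiso _ (Iso.isIso_hom _)))
          exact (toPt hV q.cocone u).2
        have := isCardinalFiltered (I := I) hκ
        have := isCardinalFiltered_subtype (κ := κ) hT
        have := final_subtype (κ := κ) hT
        let H : Subtype T ⥤ WideSubcategory W :=
          { obj := fun t => ⟨obj hE p.diag t.1⟩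
            map := fun {t r} f => ⟨map hE p.diag (leOfHom f),
              hWcoh _ (toPt hE p.cocone r.1) (by rw [map_toPt]; exact t.2)⟩
            map_id := fun t => by
              ext
              exact (colim hE p.diag κ).map_id t.1
            map_comp := fun {t r s} f g => by
              ext
              exact (colim hE p.diag κ).map_comp (homOfLE (leOfHom f)) (homOfLE (leOfHom g)) }
        let c : Cocone (H ⋙ wideSubcategoryInclusion W) :=
          (colimCocone hE κ p.cocone).whisker (Subtype.mono_coe T).functor
        have hc : IsColimit c := (Functor.Final.isColimitWhiskerEquiv
          (Subtype.mono_coe T).functor _).symm (isColimitColimCocone hE p.isColimit)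
        have := isDirectedOrder_of_isCardinalFiltered (Subtype T) κ
        have := IsCardinalFiltered.nonempty (Subtype T) κ
        refine ⟨Subtype T, inferInstance, inferInstance, ⟨⟨⟨H, (wideCocone c fun t => t.2).ι,
          isColimitWideCocone hc _ (hWcl _ H c hc).2⟩, fun t => ?_⟩⟩⟩
        have := Q.isClosedUnderColimitsOfShape_colimitsCardinalClosure κ t.1.1
          t.1.hasCardinalLT_arrow
        exact this.colimitsOfShape_le _
          ⟨⟨⟨_, (cocone hE p.diag t.1).ι, isColimitCocone hE p.diag t.1⟩,
            fun i => Q.le_colimitsCardinalClosure κ _ (p.prop_diag_obj i.1)⟩⟩ }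
  exact { toHasCardinalFilteredGenerator := hgen.hasCardinalFilteredGenerator }

end

/-! ### Directed colimits, presentability and generators in arrow categories. -/

section Arrow

variable {C : Type u₁} [Category.{v} C] {D : Type u₂} [Category.{v} D]

theorem mono_arrow (hC : ∀ ⦃X Y : C⦄ (f : X ⟶ Y), Mono f) ⦃X Y : Arrow C⦄ (f : X ⟶ Y) :
    Mono f where
  right_cancellation g h w := by
    have := hC f.left
    have := hC f.right
    ext
    · exact (cancel_mono f.left).1 (congrArg CommaMorphism.left w)
    · exact (cancel_mono f.right).1 (congrArg CommaMorphism.right w)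

theorem HasDirectedColimits.arrow (hC : HasDirectedColimits C) : HasDirectedColimits (Arrow C) :=
  fun J _ _ _ => have := hC J; inferInstance

/-- Colimits of arrows are computed on the domains and on the codomains. -/
def isColimitArrow {J : Type v} [SmallCategory J] {H : J ⥤ Arrow C} {c : Cocone H}
    (h₁ : IsColimit (Arrow.leftFunc.mapCocone c)) (h₂ : IsColimit (Arrow.rightFunc.mapCocone c)) :
    IsColimit c :=
  Comma.fstSndJointlyReflectColimit h₁ h₂

theorem PreservesDirectedColimits.mapArrow {F : C ⥤ D} (hC : HasDirectedColimits C)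
    (hF : PreservesDirectedColimits F) : PreservesDirectedColimits F.mapArrow := fun J _ _ _ =>
  have := hC J
  have := hF J
  ⟨fun {_} => ⟨fun {_} hc => ⟨isColimitArrow
    (isColimitOfPreserves F (isColimitOfPreserves Arrow.leftFunc hc))
    (isColimitOfPreserves F (isColimitOfPreserves Arrow.rightFunc hc))⟩⟩⟩

/-- Factor the two ends of the arrow separately and move both to a common stage; the square there
commutes because the leg on codomains is mono. -/
theorem isCardinalPresentable_arrow (hmono : ∀ ⦃X Y : C⦄ (f : X ⟶ Y), Mono f)
    (hC : HasDirectedColimits C) (x : Arrow C) (κ : Cardinal.{v}) [Fact κ.IsRegular]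
    [IsCardinalPresentable x.left κ] [IsCardinalPresentable x.right κ] :
    IsCardinalPresentable x κ := by
  refine isCardinalPresentable_of_mono (mono_arrow hmono) fun J _ _ H c hc f => ?_
  have := hC.hasCardinalFilteredColimits κ
  have := HasCardinalFilteredColimits.hasColimitsOfShape C (κ := κ) J
  have := isFiltered_of_isCardinalFiltered J κ
  obtain ⟨j₁, g₁, hg₁⟩ := IsCardinalPresentable.exists_hom_of_isColimit κ
    (isColimitOfPreserves Arrow.leftFunc hc) f.left
  obtain ⟨j₂, g₂, hg₂⟩ := IsCardinalPresentable.exists_hom_of_isColimit κ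
    (isColimitOfPreserves Arrow.rightFunc hc) f.right
  change x.left ⟶ (H.obj j₁).left at g₁
  change x.right ⟶ (H.obj j₂).right at g₂
  change g₁ ≫ (c.ι.app j₁).left = f.left at hg₁
  change g₂ ≫ (c.ι.app j₂).right = f.right at hg₂
  let j := IsFiltered.max j₁ j₂
  have e₁ : (H.map (IsFiltered.leftToMax j₁ j₂)).left ≫ (c.ι.app j).left = (c.ι.app j₁).left :=
    congrArg CommaMorphism.left (c.w (IsFiltered.leftToMax j₁ j₂))
  have e₂ : (H.map (IsFiltered.rightToMax j₁ j₂)).right ≫ (c.ι.app j).right =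
      (c.ι.app j₂).right :=
    congrArg CommaMorphism.right (c.w (IsFiltered.rightToMax j₁ j₂))
  have := hmono (c.ι.app j).right
  have hl : (g₁ ≫ (H.map (IsFiltered.leftToMax j₁ j₂)).left) ≫ (c.ι.app j).left = f.left := by
    rw [Category.assoc, e₁, hg₁]
  have hr : (g₂ ≫ (H.map (IsFiltered.rightToMax j₁ j₂)).right) ≫ (c.ι.app j).right = f.right := by
    rw [Category.assoc, e₂, hg₂]
  refine ⟨j, Arrow.homMk (g₁ ≫ (H.map (IsFiltered.leftToMax j₁ j₂)).left)
    (g₂ ≫ (H.map (IsFiltered.rightToMax j₁ j₂)).right) ?_, ?_⟩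
  · rw [← cancel_mono (c.ι.app j).right]
    have hw : (H.obj j).hom ≫ (c.ι.app j).right = (c.ι.app j).left ≫ c.pt.hom :=
      (Arrow.w (c.ι.app j)).symm
    rw [Category.assoc, Category.assoc x.hom, hr, hw, ← Category.assoc, hl]
    exact Arrow.w f
  · ext
    · exact hl
    · exact hr

theorem isPresentable_arrow (hmono : ∀ ⦃X Y : C⦄ (f : X ⟶ Y), Mono f)
    (hC : HasDirectedColimits C) (h : ∀ x : C, IsPresentable.{v} x) (x : Arrow C) :
    IsPresentable.{v} x := by
  obtain ⟨κ, _, _, h₁, h₂⟩ := exists_forall_isCardinalPresentable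
    (fun _ : Unit => x.left) (fun _ : Unit => x.right) (fun _ => h _) (fun _ => h _)
  have := h₁ ()
  have := h₂ ()
  have := isCardinalPresentable_arrow hmono hC x κ
  exact isPresentable_of_isCardinalPresentable x κ

theorem essentiallySmall_arrow (G : ObjectProperty C) [ObjectProperty.EssentiallySmall.{v} G] :
    ObjectProperty.EssentiallySmall.{v} (fun x : Arrow C => G x.left ∧ G x.right) := by
  obtain ⟨Q, _, hQ, hGQ⟩ := ObjectProperty.EssentiallySmall.exists_small_le G
  refine ⟨fun x => Q x.left ∧ Q x.right, ?_, fun x hx => ?_⟩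
  · let f : (Σ (a b : Subtype Q), a.1 ⟶ b.1) →
        Subtype (fun x : Arrow C => Q x.left ∧ Q x.right) :=
      fun g => ⟨Arrow.mk g.2.2, g.1.2, g.2.1.2⟩
    exact small_of_surjective (f := f) fun x => ⟨⟨⟨_, x.2.1⟩, ⟨_, x.2.2⟩, x.1.hom⟩, rfl⟩
  · obtain ⟨a, ha, ⟨e⟩⟩ := hGQ _ hx.1
    obtain ⟨b, hb, ⟨e'⟩⟩ := hGQ _ hx.2
    exact ⟨Arrow.mk (e.inv ≫ x.hom ≫ e'.hom), ⟨ha, hb⟩,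
      ⟨Arrow.isoMk e e' (by simp)⟩⟩

theorem square_comm_of_mono {a a' b b' A B : C} {m : a ⟶ a'} {n : b ⟶ b'} {l : a ⟶ b}
    {l' : a' ⟶ b'} {α : a ⟶ A} {α' : a' ⟶ A} {β : b ⟶ B} {β' : b' ⟶ B} {f : A ⟶ B} [Mono β']
    (hm : m ≫ α' = α) (hn : n ≫ β' = β) (hl : l ≫ β = α ≫ f) (hl' : l' ≫ β' = α' ≫ f) :
    m ≫ l' = l ≫ n := by
  rw [← cancel_mono β', Category.assoc, Category.assoc, hn, hl, hl', ← Category.assoc, hm]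

/-- Present domain and codomain separately and index by the pairs `(i, j)` for which the `i`-th
piece of the domain maps into the `j`-th piece of the codomain. Presentability makes such pairs
cofinal in the product, so both projections are final; monicity makes the chosen lifts natural. -/
theorem isDirectedGenerator_arrow (hmono : ∀ ⦃X Y : C⦄ (f : X ⟶ Y), Mono f)
    {G : ObjectProperty C} {κ : Cardinal.{v}} [Fact κ.IsRegular]
    (hG : G.IsCardinalFilteredGenerator κ) :
    IsDirectedGenerator (fun x : Arrow C => G x.left ∧ G x.right) := fun x => by
  obtain ⟨I', _, _, ⟨p'⟩⟩ := hG.exists_colimitsOfShape x.left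
  obtain ⟨J', _, _, ⟨q'⟩⟩ := hG.exists_colimitsOfShape x.right
  obtain ⟨I, _, _, F₁, _⟩ := IsCardinalFiltered.exists_cardinal_directed I' κ
  obtain ⟨J, _, _, F₂, _⟩ := IsCardinalFiltered.exists_cardinal_directed J' κ
  let p := p'.reindex F₁
  let q := q'.reindex F₂
  let T (z : I × J) : Prop :=
    ∃ l : p.diag.obj z.1 ⟶ q.diag.obj z.2, l ≫ q.ι.app z.2 = p.ι.app z.1 ≫ x.hom
  have hT (z : I × J) : ∃ t, T t ∧ z ≤ t := by
    have := hG.le_isCardinalPresentable _ (p.prop_diag_obj z.1)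
    rw [isCardinalPresentable_iff] at this
    obtain ⟨j, l, hl⟩ := IsCardinalPresentable.exists_hom_of_isColimit κ q.isColimit
      (p.ι.app z.1 ≫ x.hom)
    have := isDirectedOrder_of_isCardinalFiltered J κ
    obtain ⟨j', h₁, h₂⟩ := exists_ge_ge z.2 j
    refine ⟨(z.1, j'), ⟨l ≫ q.diag.map (homOfLE h₂), ?_⟩, le_rfl, h₁⟩
    rw [Category.assoc, q.w]
    exact hl
  have : @IsCardinalFiltered (I × J) (Preorder.smallCategory _) κ _ := by
    refine isCardinalFiltered_preorder (I × J) κ fun K s hK => ?_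
    have hK' := (hasCardinalLT_iff_cardinal_mk_lt K κ).2 hK
    exact ⟨(IsCardinalFiltered.max (fun k => (s k).1) hK',
      IsCardinalFiltered.max (fun k => (s k).2) hK'), fun k =>
      Prod.mk_le_mk.2 ⟨leOfHom (IsCardinalFiltered.toMax (fun k => (s k).1) hK' k),
        leOfHom (IsCardinalFiltered.toMax (fun k => (s k).2) hK' k)⟩⟩
  have := isCardinalFiltered_subtype (κ := κ) hT
  have := isFiltered_of_isCardinalFiltered (Subtype T) κ
  have := IsCardinalFiltered.nonempty I κ
  have := IsCardinalFiltered.nonempty J κ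
  have hm (j : J) : Mono (q.ι.app j) := hmono _
  choose l hl using fun t : Subtype T => t.2
  let π₁ : Subtype T ⥤ I := (monotone_fst.comp (Subtype.mono_coe T)).functor
  let π₂ : Subtype T ⥤ J := (monotone_snd.comp (Subtype.mono_coe T)).functor
  have : π₁.Final := Functor.final_of_exists_of_isFiltered _
    (fun i => by
      obtain ⟨t, ht, h⟩ := hT (i, Classical.arbitrary J)
      exact ⟨⟨t, ht⟩, ⟨homOfLE h.1⟩⟩)
    fun {_ t} _ _ => ⟨t, 𝟙 t, Subsingleton.elim _ _⟩
  have : π₂.Final := Functor.final_of_exists_of_isFiltered _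
    (fun j => by
      obtain ⟨t, ht, h⟩ := hT (Classical.arbitrary I, j)
      exact ⟨⟨t, ht⟩, ⟨homOfLE h.2⟩⟩)
    fun {_ t} _ _ => ⟨t, 𝟙 t, Subsingleton.elim _ _⟩
  let P := p.toColimitPresentation.reindex π₁
  let Q := q.toColimitPresentation.reindex π₂
  let H : Subtype T ⥤ Arrow C :=
    { obj := fun t => Arrow.mk (l t)
      map := fun {s t} f => Arrow.homMk (P.diag.map f) (Q.diag.map f) (by
        have h₁ : P.diag.map f ≫ p.ι.app t.1.1 = p.ι.app s.1.1 := P.w f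
        have h₂ : Q.diag.map f ≫ q.ι.app t.1.2 = q.ι.app s.1.2 := Q.w f
        have := hm t.1.2
        exact square_comm_of_mono h₁ h₂ (hl s) (hl t))
      map_id := fun t => by
        ext
        · exact P.diag.map_id t
        · exact Q.diag.map_id t
      map_comp := fun f g => by
        ext
        · exact P.diag.map_comp f g
        · exact Q.diag.map_comp f g }
  let c : Cocone H :=
    { pt := x
      ι :=
        { app := fun t => Arrow.homMk (P.ι.app t) (Q.ι.app t) (hl t).symm
          naturality := fun s t f => by
            ext
            · exact P.ι.naturality f
            · exact Q.ι.naturality f } }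
  have hc : IsColimit c := isColimitArrow P.isColimit Q.isColimit
  exact ⟨Subtype T, inferInstance, isDirectedOrder_of_isCardinalFiltered _ κ,
    IsCardinalFiltered.nonempty _ κ,
    ⟨⟨⟨H, c.ι, hc⟩, fun t => ⟨p.prop_diag_obj t.1.1, q.prop_diag_obj t.1.2⟩⟩⟩⟩

end Arrow

/-! ### Properties of the lifted relation. -/

section Lift

variable {C : Type u₁} [Category.{v} C] {D : Type u₂} [Category.{v} D]
  {F : C ⥤ D} {R : IndependenceRelation D}

namespace IndependenceRelation

variable {R : IndependenceRelation D}

theorem squares_of_isIso (hb : R.BasicExistence) ⦃X Y : Arrow D⦄ (φ : X ⟶ Y) (_ : IsIso φ) :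
    R.squares φ :=
  hb _ _ _ _ (Arrow.w φ).symm (Or.inr inferInstance)

/-- Monotonicity shrinks the far corner of the composite to that of `φ`, and invariance then removes
`ψ.right` from the vertex. -/
theorem squares_of_comp (hi : R.Invariance) (hm : R.Monotonicity) ⦃X Y Z : Arrow D⦄
    (φ : X ⟶ Y) (ψ : Y ⟶ Z) (h : R.squares (φ ≫ ψ)) : R.squares φ := by
  have h₁ : R.indep X.hom φ.left (φ.right ≫ ψ.right) (ψ.left ≫ Z.hom) := hm _ _ _ _ _ h
  have h₂ : ψ.left ≫ Z.hom = Y.hom ≫ ψ.right := Arrow.w ψ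
  rw [h₂] at h₁
  exact (hi _ _ _ _ ψ.right (Arrow.w φ).symm).2 h₁

theorem Existence.canAmalgamate (he : R.Existence) {X A B : D} (f : X ⟶ A) (g : X ⟶ B) :
    ∃ (M : D) (a : A ⟶ M) (b : B ⟶ M), f ≫ a = g ≫ b := by
  obtain ⟨M, a, b, h⟩ := he f g
  exact ⟨M, a, b, R.comm h⟩

/-- Amalgamating both `N₁` and `N₂` over a vertex `E` of an independent square. -/
theorem exists_of_canAmalgamate (hi : R.Invariance) (he : R.Existence)
    {M A B C' N₁ N₂ N₃ E : D} {mA : M ⟶ A} {mB : M ⟶ B}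
    {a₁ : A ⟶ N₁} {b₁ : B ⟶ N₁} {a₂ : A ⟶ N₂} {c₂ : C' ⟶ N₂} {b₃ : B ⟶ N₃} {c₃ : C' ⟶ N₃}
    {aE : A ⟶ E} {n₃ : N₃ ⟶ E} (h : R.indep mA (mB ≫ b₃) aE n₃)
    (h₁ : CanAmalgamate a₁ b₁ aE (b₃ ≫ n₃)) (h₂ : CanAmalgamate a₂ c₂ aE (c₃ ≫ n₃)) :
    ∃ (N : D) (n₁ : N₁ ⟶ N) (n₂ : N₂ ⟶ N) (n₃ : N₃ ⟶ N),
      a₁ ≫ n₁ = a₂ ≫ n₂ ∧ b₁ ≫ n₁ = b₃ ≫ n₃ ∧ c₂ ≫ n₂ = c₃ ≫ n₃ ∧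
      R.indep mA (mB ≫ b₃) (a₁ ≫ n₁) n₃ := by
  obtain ⟨E₁, d, d', hd, hd'⟩ := h₁
  obtain ⟨E₂, e, e', hE, hE'⟩ := h₂
  -- The two amalgams both receive `E`, and are glued over it.
  obtain ⟨N, u, w, huw⟩ := he.canAmalgamate d' e'
  refine ⟨N, d ≫ u, e ≫ w, n₃ ≫ d' ≫ u, ?_, ?_, ?_, ?_⟩
  · rw [← Category.assoc, hd, ← Category.assoc, hE, Category.assoc, Category.assoc, huw]
  · rw [← Category.assoc, hd', Category.assoc, Category.assoc]
  · rw [← Category.assoc, hE', huw, Category.assoc, Category.assoc]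
  · rw [← Category.assoc, hd, Category.assoc]
    exact (hi _ _ _ _ (d' ≫ u) (R.comm h)).1 h

/-- Place `A` independently of `N₃`. By monotonicity it is then independent of `B` and of `C'`, so
uniqueness amalgamates with `N₁` and with `N₂`. -/
theorem Uniqueness.threeAmalgamation (hu : R.Uniqueness) (hi : R.Invariance)
    (hm : R.Monotonicity) (he : R.Existence) : R.ThreeAmalgamation := by
  intro M A B C' N₁ N₂ N₃ mA mB mC a₁ b₁ a₂ c₂ b₃ c₃ h
  obtain ⟨E, aE, n₃, hE⟩ := he mA (mB ≫ b₃)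
  refine exists_of_canAmalgamate hi he hE (hu _ _ _ _ _ _ h.indep₁ (hm _ _ _ _ _ hE))
    (hu _ _ _ _ _ _ h.indep₂ (hm _ mC c₃ _ _ ?_))
  rwa [← R.comm h.indep₃]

/-- Build an independent configuration by existence, over `X` and then over `B`. By transitivity its
outer square is independent over the same span as the given one, so uniqueness carries the inner
independence into an extension of `M`. -/
theorem Uniqueness.baseMonotonicity (hu : R.Uniqueness) (hi : R.Invariance)
    (ht : R.Transitivity) (he : R.Existence) : R.BaseMonotonicity := by
  intro X A B D' M f g h a d hM
  obtain ⟨A', p, q, hpq⟩ := he f g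
  obtain ⟨N₀, r₀, d₀, hN⟩ := he q h
  obtain ⟨N, s₀, s, h₁, h₂⟩ := hu _ _ _ _ _ _ (ht _ _ _ _ _ _ _ hpq hN) hM
  refine ⟨A', N, p, q, r₀ ≫ s₀, s, R.comm hpq, by rw [← Category.assoc, h₁], ?_⟩
  rw [← h₂]
  exact (hi _ _ _ _ s₀ (R.comm hN)).1 hN

theorem StrongThreeAmalgamation.threeAmalgamation (hs : R.StrongThreeAmalgamation)
    (ht : R.Transitivity) : R.ThreeAmalgamation := by
  intro M A B C' N₁ N₂ N₃ mA mB mC a₁ b₁ a₂ c₂ b₃ c₃ h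
  obtain ⟨N, n₁, n₂, n₃, hN⟩ := hs _ _ _ _ _ _ _ _ _ h
  exact ⟨N, n₁, n₂, n₃, R.comm hN.indepA, R.comm hN.indepB, R.comm hN.indepC,
    ht _ _ _ _ _ _ _ h.indep₁ hN.indepB⟩

end IndependenceRelation

open IndependenceRelation

theorem lift_squares_iff ⦃X Y : Arrow C⦄ (φ : X ⟶ Y) :
    (lift F R).squares φ ↔ R.squares (F.mapArrow.map φ) :=
  ⟨fun h => h.2, fun h => ⟨(Arrow.w φ).symm, h⟩⟩

theorem lift_invariance (hi : R.Invariance) : (lift F R).Invariance := by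
  intro X A B M N f g a b n w
  have := hi (F.map f) (F.map g) (F.map a) (F.map b) (F.map n)
    (by rw [← F.map_comp, w, F.map_comp])
  refine ⟨fun h => ⟨?_, ?_⟩, fun h => ⟨w, ?_⟩⟩
  · rw [← Category.assoc, w, Category.assoc]
  · rw [F.map_comp, F.map_comp]
    exact this.1 h.2
  · rw [this, ← F.map_comp, ← F.map_comp]
    exact h.2

theorem lift_monotonicity (hm : R.Monotonicity) : (lift F R).Monotonicity := by
  intro X A B' B M f g h a b hM
  refine ⟨by rw [hM.1, Category.assoc], ?_⟩
  rw [F.map_comp]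
  refine hm _ _ _ _ _ ?_
  rw [← F.map_comp]
  exact hM.2

theorem lift_transitivity (ht : R.Transitivity) : (lift F R).Transitivity := by
  intro X A B M D' N f g a b d m n h h'
  refine ⟨by rw [← Category.assoc, h.1, Category.assoc, h'.1, Category.assoc], ?_⟩
  rw [F.map_comp, F.map_comp]
  exact ht _ _ _ _ _ _ _ h.2 h'.2

theorem lift_symmetry (hs : R.Symmetry) : (lift F R).Symmetry := by
  intro X A B M f g a b
  exact ⟨fun h => ⟨h.1.symm, (hs _ _ _ _).1 h.2⟩, fun h => ⟨h.1.symm, (hs _ _ _ _).1 h.2⟩⟩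

/-- A 2-completion of an independent square is independent for the lifted relation. -/
theorem IsTwoCompletion.lift_indep [F.Faithful] (hi : R.Invariance) {X A B E : C} {N : D}
    {f : X ⟶ A} {g : X ⟶ B} {a : F.obj A ⟶ N} {b : F.obj B ⟶ N} {p : A ⟶ E} {q : B ⟶ E}
    {h : N ⟶ F.obj E} (hE : IsTwoCompletion F a b p q h)
    (hN : R.indep (F.map f) (F.map g) a b) : (lift F R).indep f g p q := by
  have := (hi _ _ _ _ h (R.comm hN)).1 hN
  rw [hE.1, hE.2] at this
  exact ⟨F.map_injective (by simpa using R.comm this), this⟩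

theorem lift_existence [F.Faithful] (hi : R.Invariance) (he : R.Existence)
    (h₂ : AdmitsTwoCompletions F R) : (lift F R).Existence := by
  intro X A B f g
  obtain ⟨N, a, b, h⟩ := he (F.map f) (F.map g)
  obtain ⟨E, p, q, k, hE⟩ := h₂ f g a b h
  exact ⟨E, p, q, hE.lift_indep hi h⟩

theorem lift_uniqueness (hu : R.Uniqueness) (hF : ReflectsAmalgamationOfSquares F) :
    (lift F R).Uniqueness := fun _ _ _ _ _ _ _ _ _ _ _ h h' =>
  hF _ _ _ _ _ _ h.1 h'.1 (hu _ _ _ _ _ _ h.2 h'.2)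

theorem isIndepHorn_map {M A B C' N₁ N₂ N₃ : C} {mA : M ⟶ A} {mB : M ⟶ B} {mC : M ⟶ C'}
    {a₁ : A ⟶ N₁} {b₁ : B ⟶ N₁} {a₂ : A ⟶ N₂} {c₂ : C' ⟶ N₂} {b₃ : B ⟶ N₃} {c₃ : C' ⟶ N₃}
    (h : (lift F R).IsIndepHorn mA mB mC a₁ b₁ a₂ c₂ b₃ c₃) :
    R.IsIndepHorn (F.map mA) (F.map mB) (F.map mC) (F.map a₁) (F.map b₁) (F.map a₂) (F.map c₂)
      (F.map b₃) (F.map c₃) :=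
  ⟨h.indep₁.2, h.indep₂.2, h.indep₃.2⟩

theorem lift_threeAmalgamation [F.Faithful] (hi : R.Invariance) (he : R.Existence)
    (h₃ : R.ThreeAmalgamation) (h₂ : AdmitsTwoCompletions F R)
    (hF : HasIndepHornAmalgamation F R) : (lift F R).ThreeAmalgamation := by
  intro M A B C' N₁ N₂ N₃ mA mB mC a₁ b₁ a₂ c₂ b₃ c₃ h
  have hh := isIndepHorn_map h
  obtain ⟨N, n₁, n₂, n₃, e₁, e₂, e₃, hN⟩ := h₃ _ _ _ _ _ _ _ _ _ hh
  rw [← F.map_comp] at hN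
  obtain ⟨E, aE, n₃', k, hE, h', h''⟩ := hF mA mB mC a₁ b₁ a₂ c₂ b₃ c₃ _ n₃ hh hN
  exact exists_of_canAmalgamate (lift_invariance hi) (lift_existence hi he h₂)
    (hE.lift_indep hi hN) h' h''

theorem lift_strongThreeAmalgamation [F.Faithful] (hi : R.Invariance)
    (h₃ : R.StrongThreeAmalgamation) (hF : AdmitsThreeCompletions F R) :
    (lift F R).StrongThreeAmalgamation := by
  intro M A B C' N₁ N₂ N₃ mA mB mC a₁ b₁ a₂ c₂ b₃ c₃ h
  obtain ⟨N, k₁, k₂, k₃, hN⟩ := h₃ _ _ _ _ _ _ _ _ _ (isIndepHorn_map h)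
  obtain ⟨E, n₁, n₂, n₃, k, e₁, e₂, e₃⟩ := hF mA mB mC a₁ b₁ a₂ c₂ b₃ c₃ k₁ k₂ k₃ hN
  exact ⟨E, n₁, n₂, n₃,
    { toIsIndepHorn := h
      indepA := IsTwoCompletion.lift_indep hi ⟨e₁, e₂⟩ hN.indepA
      indepB := IsTwoCompletion.lift_indep hi ⟨e₁, e₃⟩ hN.indepB
      indepC := IsTwoCompletion.lift_indep hi ⟨e₂, e₃⟩ hN.indepC }⟩

theorem lift_union (hF : IsReductFunctor F) (hb : R.BasicExistence) (ht : R.Transitivity)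
    (hR : R.Union hb ht) (hb' : (lift F R).BasicExistence) (ht' : (lift F R).Transitivity) :
    (lift F R).Union hb' ht' := by
  have := squares_isMultiplicative hb ht
  have := squares_isMultiplicative hb' ht'
  have hC := hF.source.hasDirectedColimits
  have h : ClosedUnderDirectedColimits (lift F R).squares :=
    (closedUnderDirectedColimits_of_preserves hR.1 hR.2 (squares_of_isIso hb)).of_functor
      (hF.preservesDirectedColimits.mapArrow hC) lift_squares_iff
  exact ⟨h.hasDirectedColimits hC.arrow, h.preservesDirectedColimits hC.arrow⟩

/-- `isAccessibleCategory_wide` applied to `F.mapArrow`, with left cancellation given by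
`squares_of_comp`. -/
theorem lift_accessible (hF : IsReductFunctor F) (hi : R.Invariance) (hm : R.Monotonicity)
    (hb : R.BasicExistence) (ht : R.Transitivity) (hR : R.Union hb ht) (hRa : R.Accessible hb ht)
    (hb' : (lift F R).BasicExistence) (ht' : (lift F R).Transitivity) :
    (lift F R).Accessible hb' ht' := by
  have := squares_isMultiplicative hb ht
  have := squares_isMultiplicative hb' ht'
  have := hF.source.accessible
  have := hF.target.accessible
  have hC := hF.source.hasDirectedColimits
  obtain ⟨κ, _, _⟩ := IsAccessibleCategory.exists_cardinal C
  obtain ⟨G, _, hG⟩ := HasCardinalFilteredGenerator.exists_generator C κ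
  have := essentiallySmall_arrow G
  exact isAccessibleCategory_wide (mono_arrow hF.source.mono) (mono_arrow hF.target.mono)
    hC.arrow (hF.preservesDirectedColimits.mapArrow hC) hR.1 hR.2 hRa (squares_of_isIso hb)
    (squares_of_comp hi hm) lift_squares_iff
    (isPresentable_arrow hF.source.mono hC fun _ => inferInstance)
    (isPresentable_arrow hF.target.mono hF.target.hasDirectedColimits fun _ => inferInstance)
    (isDirectedGenerator_arrow hF.source.mono hG)

theorem lift_isNSOP₁Like (hF : IsReductFunctor F) (h₂ : AdmitsTwoCompletions F R)
    (h : R.IsNSOP₁Like) (h₃ : (lift F R).ThreeAmalgamation) : (lift F R).IsNSOP₁Like :=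
  haveI := hF.faithful
  { invariance := lift_invariance h.invariance
    monotonicity := lift_monotonicity h.monotonicity
    transitivity := lift_transitivity h.transitivity
    symmetry := lift_symmetry h.symmetry
    existence := lift_existence h.invariance h.existence h₂
    threeAmalgamation := h₃
    accessible := lift_accessible hF h.invariance h.monotonicity
      (basicExistence_of h.invariance h.existence) h.transitivity h.union h.accessible _ _
    union := lift_union hF (basicExistence_of h.invariance h.existence) h.transitivity h.union
      _ _ }

end Lift

/-! ### Joins of subobjects and base monotonicity. -/

section Joins

variable {C : Type u₁} [Category.{v} C] {D : Type u₂} [Category.{v} D]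

/-- `p` and `q` are jointly extremal: `J` is the join of `A` and `B` in every object that it
maps to. -/
def IsJoin {A B J : C} (p : A ⟶ J) (q : B ⟶ J) : Prop :=
  ∀ ⦃N Z : C⦄ (t : J ⟶ N) (z : Z ⟶ N) (a : A ⟶ Z) (b : B ⟶ Z), a ≫ z = p ≫ t → b ≫ z = q ≫ t →
    ∃ l : J ⟶ Z, l ≫ z = t

theorem IsJoin.symm {A B J : C} {p : A ⟶ J} {q : B ⟶ J} (h : IsJoin p q) : IsJoin q p :=
  fun _ _ t z a b ha hb => h t z b a hb ha

/-- A least upper bound in `Subobject M` is a priori minimal only inside `M`, while base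
monotonicity enlarges the vertex. The join taken in `N` lies below both `t` and `z`. Seen inside
`J`, it contains `A` and `B`, so minimality of `J` in `M` shows it is all of `J`. -/
theorem isJoin_of_isLUB (hC : HasBinaryJoinsOfSubobjects C)
    (hmono : ∀ ⦃X Y : C⦄ (f : X ⟶ Y), Mono f) {A B J M : C} {p : A ⟶ J} {q : B ⟶ J} {j : J ⟶ M}
    {a : A ⟶ M} {b : B ⟶ M} [Mono a] [Mono b] [Mono j] (ha : p ≫ j = a) (hb : q ≫ j = b)
    (h : IsLUB {Subobject.mk a, Subobject.mk b} (Subobject.mk j)) : IsJoin p q := by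
  intro N Z t z u w hu hw
  have := hmono t
  have := hmono z
  have := hmono (p ≫ t)
  have := hmono (q ≫ t)
  obtain ⟨J', hJ', hJ''⟩ := hC N (Subobject.mk (p ≫ t)) (Subobject.mk (q ≫ t))
  have hp : Subobject.mk (p ≫ t) ≤ J' := hJ' (Or.inl rfl)
  have hq : Subobject.mk (q ≫ t) ≤ J' := hJ' (Or.inr rfl)
  have ht : J' ≤ Subobject.mk t := hJ'' (by
    rintro _ (rfl | rfl)
    · exact Subobject.mk_le_mk_of_comm p rfl
    · exact Subobject.mk_le_mk_of_comm q rfl)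
  have hz : J' ≤ Subobject.mk z := hJ'' (by
    rintro _ (rfl | rfl)
    · exact Subobject.mk_le_mk_of_comm u hu
    · exact Subobject.mk_le_mk_of_comm w hw)
  let i := Subobject.ofLEMk J' t ht
  have hi : i ≫ t = J'.arrow := Subobject.ofLEMk_comp ht
  have := hmono (i ≫ j)
  have hpi : Subobject.ofMkLE (p ≫ t) J' hp ≫ i = p := by
    rw [← cancel_mono t, Category.assoc, hi, Subobject.ofMkLE_arrow]
  have hqi : Subobject.ofMkLE (q ≫ t) J' hq ≫ i = q := by
    rw [← cancel_mono t, Category.assoc, hi, Subobject.ofMkLE_arrow]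
  have hj : Subobject.mk j ≤ Subobject.mk (i ≫ j) := h.2 (by
    rintro _ (rfl | rfl)
    · exact Subobject.mk_le_mk_of_comm (Subobject.ofMkLE (p ≫ t) J' hp)
        (by rw [← Category.assoc, hpi, ha])
    · exact Subobject.mk_le_mk_of_comm (Subobject.ofMkLE (q ≫ t) J' hq)
        (by rw [← Category.assoc, hqi, hb]))
  let k := Subobject.ofMkLEMk j (i ≫ j) hj
  have hk : k ≫ i = 𝟙 J := by
    rw [← cancel_mono j, Category.assoc, Category.id_comp]
    exact Subobject.ofMkLEMk_comp hj
  refine ⟨k ≫ Subobject.ofLEMk J' z hz, ?_⟩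
  rw [Category.assoc, Subobject.ofLEMk_comp, ← hi, ← Category.assoc, hk, Category.id_comp]

theorem exists_isJoin_map (hC : HasBinaryJoinsOfSubobjects C) (hD : HasBinaryJoinsOfSubobjects D)
    (hmono : ∀ ⦃X Y : C⦄ (f : X ⟶ Y), Mono f) (hmono' : ∀ ⦃X Y : D⦄ (f : X ⟶ Y), Mono f)
    {F : C ⥤ D} (hF : PreservesBinaryJoinsOfSubobjects F) {A B M : C} (a : A ⟶ M) (b : B ⟶ M) :
    ∃ (J : C) (p : A ⟶ J) (q : B ⟶ J) (j : J ⟶ M), p ≫ j = a ∧ q ≫ j = b ∧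
      IsJoin (F.map p) (F.map q) := by
  have := hmono a
  have := hmono b
  obtain ⟨J, hJ⟩ := hC M (Subobject.mk a) (Subobject.mk b)
  have ha : Subobject.mk a ≤ J := hJ.1 (Or.inl rfl)
  have hb : Subobject.mk b ≤ J := hJ.1 (Or.inr rfl)
  refine ⟨_, Subobject.ofMkLE a J ha, Subobject.ofMkLE b J hb, J.arrow,
    Subobject.ofMkLE_arrow ha, Subobject.ofMkLE_arrow hb, ?_⟩
  have := hF.preservesMono
  refine isJoin_of_isLUB hD hmono' (j := F.map J.arrow) (a := F.map a) (b := F.map b)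
    (by rw [← F.map_comp, Subobject.ofMkLE_arrow]) (by rw [← F.map_comp, Subobject.ofMkLE_arrow])
    (hF.isLUB a b J.arrow ?_)
  rwa [Subobject.mk_arrow]

/-- In the presence of joins, base monotonicity needs no enlargement of the vertex. -/
theorem IndependenceRelation.BaseMonotonicity.indep_of_isJoin {R : IndependenceRelation D}
    (hb : R.BaseMonotonicity) (hi : R.Invariance) (hm : R.Monotonicity) (hs : R.Symmetry)
    (hmono : ∀ ⦃X Y : D⦄ (f : X ⟶ Y), Mono f)
    {X A B E M J : D} {f : X ⟶ A} {g : X ⟶ B} {h : B ⟶ E} {a : A ⟶ M} {d : E ⟶ M}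
    (hM : R.indep f (g ≫ h) a d) {p : A ⟶ J} {q : B ⟶ J} {j : J ⟶ M} (hp : p ≫ j = a)
    (hq : q ≫ j = h ≫ d) (hJ : IsJoin p q) : R.indep q h j d := by
  -- Inside `N` the join `J` lies in `A'`. Symmetry and monotonicity shrink `A'` to `J`, and
  -- invariance returns from `N` to `M`.
  obtain ⟨A', N, p', q', r, s, -, h₂, h₃⟩ := hb f g h a d hM
  have hr := hmono r
  have hqs : q' ≫ r = q ≫ j ≫ s := by
    rw [R.comm h₃, ← Category.assoc, ← hq, Category.assoc]
  obtain ⟨l, hl⟩ := hJ (j ≫ s) r p' q' (by rw [h₂, ← hp, Category.assoc]) hqs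
  have hql : q ≫ l = q' := by rw [← cancel_mono r, Category.assoc, hl, hqs]
  rw [← hql, hs] at h₃
  have h₄ := hm _ _ _ _ _ h₃
  rw [hl, hs] at h₄
  exact (hi _ _ _ _ s hq).2 h₄

end Joins

/-! ### The simple case. -/

section Simple

open IndependenceRelation

variable {C : Type u₁} [Category.{v} C] {D : Type u₂} [Category.{v} D]
  {F : C ⥤ D} {R : IndependenceRelation D}

theorem lift_baseMonotonicity (hF : IsReductFunctor F) (h : R.IsSimple)
    (hC : HasBinaryJoinsOfSubobjects C) (hD : HasBinaryJoinsOfSubobjects D)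
    (hJ : PreservesBinaryJoinsOfSubobjects F) : (lift F R).BaseMonotonicity := by
  intro X A B E M f g h' a d hM
  obtain ⟨J, p, q, j, hp, hq, hpq⟩ :=
    exists_isJoin_map hC hD hF.source.mono hF.target.mono hJ a (h' ≫ d)
  have hj := hF.source.mono j
  refine ⟨J, M, p, q, j, 𝟙 M, ?_, by simpa using hp, by simpa using hq, ?_⟩
  · rw [← cancel_mono j, Category.assoc, Category.assoc, hp, hq, hM.1, Category.assoc]
  · have hM' := hM.2
    rw [F.map_comp] at hM'
    rw [Category.comp_id]
    exact h.baseMonotonicity.indep_of_isJoin h.invariance h.monotonicity h.symmetry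
      hF.target.mono hM' (by rw [← F.map_comp, hp]) (by rw [← F.map_comp, hq, F.map_comp]) hpq

/-- 3-completions need an independent cube, but 3-amalgamation in `D` gives only one independent
square. Cutting `N₁` and `N₂` down to joins allows base monotonicity to prove the remaining faces
independent. -/
theorem lift_threeAmalgamation_of_isSimple (hF : IsReductFunctor F)
    (h₂ : AdmitsTwoCompletions F R) (h : R.IsSimple)
    (hC : HasBinaryJoinsOfSubobjects C) (hD : HasBinaryJoinsOfSubobjects D)
    (hJ : PreservesBinaryJoinsOfSubobjects F) (h₃ : AdmitsThreeCompletions F R) :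
    (lift F R).ThreeAmalgamation := by
  intro M A B C' N₁ N₂ N₃ mA mB mC a₁ b₁ a₂ c₂ b₃ c₃ hh
  have := hF.faithful
  have hi := h.invariance
  have he := lift_existence hi h.existence h₂
  have join {X A B E M J : D} {f : X ⟶ A} {g : X ⟶ B} {h' : B ⟶ E} {a : A ⟶ M} {d : E ⟶ M}
      (hM : R.indep f (g ≫ h') a d) {p : A ⟶ J} {q : B ⟶ J} {j : J ⟶ M} :=
    h.baseMonotonicity.indep_of_isJoin hi h.monotonicity h.symmetry hF.target.mono hM
      (p := p) (q := q) (j := j)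
  obtain ⟨J₁, p₁, q₁, j₁, rfl, rfl, hJ₁⟩ :=
    exists_isJoin_map hC hD hF.source.mono hF.target.mono hJ a₁ b₁
  obtain ⟨J₂, p₂, q₂, j₂, rfl, rfl, hJ₂⟩ :=
    exists_isJoin_map hC hD hF.source.mono hF.target.mono hJ a₂ c₂
  have i₁ := ((lift_invariance hi) _ _ _ _ j₁ (by
    have := hF.source.mono j₁
    rw [← cancel_mono j₁]
    simpa using hh.indep₁.1)).2 hh.indep₁
  have i₂ := ((lift_invariance hi) _ _ _ _ j₂ (by
    have := hF.source.mono j₂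
    rw [← cancel_mono j₂]
    simpa using hh.indep₂.1)).2 hh.indep₂
  obtain ⟨N, n₁, n₂, n₃, e₁, e₂, e₃, hN⟩ := h.threeAmalgamation _ _ _ _ _ _ _ _ _
    (isIndepHorn_map hh)
  simp only [F.map_comp, Category.assoc] at e₁ e₂ e₃ hN
  have hB : R.indep (F.map q₁) (F.map b₃) (F.map j₁ ≫ n₁) n₃ := join hN rfl e₂ hJ₁
  have hC' : R.indep (F.map q₂) (F.map c₃) (F.map j₂ ≫ n₂) n₃ := by
    -- The base map of the square can equally be factored through `C'`, which becomes the new base.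
    rw [R.comm hh.indep₃.2] at hN
    exact join hN e₁.symm e₃ hJ₂
  have hA : R.indep (F.map p₁) (F.map p₂) (F.map j₁ ≫ n₁) (F.map j₂ ≫ n₂) := by
    -- `B` is independent of `C'`, and `N₃` of `J₂` over `C'`, so `B` is independent of `J₂` over
    -- `M`. Moving the base to `A` replaces `B` by its join with `A`, which is `J₁`.
    have ht := h.transitivity _ _ _ _ _ _ _ hh.indep₃.2 ((h.symmetry _ _ _ _).1 hC')
    rw [← R.comm i₂.2] at ht
    exact join ht e₂ e₁ hJ₁.symm
  obtain ⟨E, m₁, m₂, m₃, k, f₁, f₂, f₃⟩ := h₃ mA mB mC p₁ q₁ p₂ q₂ b₃ c₃ _ _ _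
    { indep₁ := i₁.2, indep₂ := i₂.2, indep₃ := hh.indep₃.2
      indepA := hA, indepB := hB, indepC := hC' }
  have gA := (IsTwoCompletion.lift_indep hi ⟨f₁, f₂⟩ hA).1
  have gB := (IsTwoCompletion.lift_indep hi ⟨f₁, f₃⟩ hB).1
  have gC := (IsTwoCompletion.lift_indep hi ⟨f₂, f₃⟩ hC').1
  rw [← F.map_comp] at hN
  have hE : (lift F R).indep mA (mB ≫ b₃) (p₁ ≫ m₁) m₃ :=
    IsTwoCompletion.lift_indep hi
      ⟨by rw [F.map_comp, ← f₁, Category.assoc, Category.assoc], f₃⟩ hN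
  -- The completed cube contains only the joins; gluing over `J₁` and `J₂` brings back `N₁` and
  -- `N₂`.
  obtain ⟨E₁, d, d', hd⟩ := he.canAmalgamate j₁ m₁
  obtain ⟨E₂, e, e', hE'⟩ := he.canAmalgamate j₂ m₂
  refine exists_of_canAmalgamate (lift_invariance hi) he hE ⟨E₁, d, d', ?_, ?_⟩
    ⟨E₂, e, e', ?_, ?_⟩
  · simp only [Category.assoc, hd]
  · rw [← gB]
    simp only [Category.assoc, hd]
  · rw [gA]
    simp only [Category.assoc, hE']
  · rw [← gC]
    simp only [Category.assoc, hE']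

end Simple

end IndepLift

/-! ### Assembly of the four clauses. -/

theorem mainTheorem1 {C : Type u₁} [Category.{v} C] {D : Type u₂} [Category.{v} D]
    (F : C ⥤ D) (R : IndepLift.IndependenceRelation D)
    (hF : IndepLift.IsReductFunctor F) (h₂ : IndepLift.AdmitsTwoCompletions F R) :
    (R.IsStable → IndepLift.ReflectsAmalgamationOfSquares F →
      (IndepLift.lift F R).IsStable) ∧
    (R.IsSimple →
      IndepLift.HasBinaryJoinsOfSubobjects C → IndepLift.HasBinaryJoinsOfSubobjects D →
      IndepLift.PreservesBinaryJoinsOfSubobjects F →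
      (IndepLift.HasIndepHornAmalgamation F R ∨ IndepLift.AdmitsThreeCompletions F R) →
      (IndepLift.lift F R).IsSimple) ∧
    (R.IsNSOP₁Like → IndepLift.HasIndepHornAmalgamation F R →
      (IndepLift.lift F R).IsNSOP₁Like) ∧
    (R.IsNSOP₁Like → R.StrongThreeAmalgamation → IndepLift.AdmitsThreeCompletions F R →
      (IndepLift.lift F R).IsNSOP₁Like ∧ (IndepLift.lift F R).StrongThreeAmalgamation) := by
  have := hF.faithful
  refine ⟨fun h hA => ?_, fun h hC hD hJ h₃ => ?_, fun h h₃ => ?_, fun h hs h₃ => ?_⟩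
  · have hi := IndepLift.lift_invariance (F := F) h.invariance
    have hu := IndepLift.lift_uniqueness h.uniqueness hA
    have he := IndepLift.lift_existence h.invariance h.existence h₂
    exact
      { toIsNSOP₁Like := IndepLift.lift_isNSOP₁Like hF h₂ h.toIsNSOP₁Like
          (hu.threeAmalgamation hi (IndepLift.lift_monotonicity h.monotonicity) he)
        baseMonotonicity := hu.baseMonotonicity hi (IndepLift.lift_transitivity h.transitivity) he
        uniqueness := hu }
  · refine
      { toIsNSOP₁Like := IndepLift.lift_isNSOP₁Like hF h₂ h.toIsNSOP₁Like ?_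
        baseMonotonicity := IndepLift.lift_baseMonotonicity hF h hC hD hJ }
    rcases h₃ with h₃ | h₃
    · exact IndepLift.lift_threeAmalgamation h.invariance h.existence h.threeAmalgamation h₂ h₃
    · exact IndepLift.lift_threeAmalgamation_of_isSimple hF h₂ h hC hD hJ h₃
  · exact IndepLift.lift_isNSOP₁Like hF h₂ h
      (IndepLift.lift_threeAmalgamation h.invariance h.existence h.threeAmalgamation h₂ h₃)
  · have hs' := IndepLift.lift_strongThreeAmalgamation h.invariance hs h₃
    exact ⟨IndepLift.lift_isNSOP₁Like hF h₂ h
      (hs'.threeAmalgamation (IndepLift.lift_transitivity h.transitivity)), hs'⟩
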